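/- Let $n\ge 1$ and let $M$ be a smooth manifold of dimension $2n+1$ with a contact sub-Riemannian structure $(\Pi,g)$: $\Pi\subset TM$ is a smooth subbundle of rank $2n$ such that $\alpha\wedge(d\alpha)^n\neq 0$ everywhere for every nowhere zero local section $\alpha$ of its annihilator $\operatorname{Ann}\Pi\subset T^*M$, and $g$ is a smooth Riemannian metric on the bundle $\Pi$. Locally there is a contact form $\alpha$ with $\ker\alpha=\Pi$ normalized by $(d\alpha)^n|_\Pi=\pm\mathrm{vol}_g$ (that is, $(d\alpha)^n$ takes the values $\pm1$ on $g$-orthonormal frames of $\Pi$); it is unique up to sign, and so is its Reeb field $\nu_\alpha$, given by $\alpha(\nu_\alpha)=1$ and $i_{\nu_\alpha}d\alpha=0$. The structure is called Reeb-symmetric if $L_{\nu_\alpha}g=0$ on $\Pi$, i.e. for all local smooth sections $X,Y$ of $\Pi$ the brackets $[\nu_\alpha,X]$ and $[\nu_\alpha,Y]$ are sections of $\Pi$ and $\nu_\alpha(g(X,Y))=g([\nu_\alpha,X],Y)+g(X,[\nu_\alpha,Y])$. The Reeb momentum is the function $I_g(p)=\langle p,\nu_\alpha\rangle^2$ on $T^*M$,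 which does not depend on the sign of $\nu_\alpha$. The sub-Riemannian geodesic flow is the (possibly incomplete) Hamiltonian flow on $T^*M$, with its standard symplectic structure $\Omega=dx\wedge dp$ and the convention $\Omega(\operatorname{sgrad}H,\cdot)=dH$, of $H(p)=\tfrac12\|\#^g(p|_\Pi)\|_g^2$, where $\#^g(p|_\Pi)\in\Pi$ is the vector with $g(\#^g(p|_\Pi),w)=\langle p,w\rangle$ for all $w\in\Pi$. Then $(\Pi,g)$ is Reeb-symmetric if and only if $I_g$ is a first integral of the sub-Riemannian geodesic flow, i.e. $I_g$ is constant along every trajectory of $\operatorname{sgrad}H$. -/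

import Mathlib

open scoped Manifold ContDiff

noncomputable section

namespace ContactSR

/-! ### Differential forms of low degree on a manifold -/

section Forms

variable {E : Type*} [NormedAddCommGroup E] [NormedSpace ℝ E]
  {H : Type*} [TopologicalSpace H] (I : ModelWithCorners ℝ E H)
  {M : Type*} [TopologicalSpace M] [ChartedSpace H M]

/-- The coordinate expression, in the preferred chart `φ` at `x₀`, of a `1`-form `α` on `M`: the
`1`-form `q ↦ α_{φ⁻¹ q} ∘ D(φ⁻¹)_q` on (an open subset of) the model vector space, written as an
alternating form of degree one. -/
def formInChart (α : ∀ x : M, TangentSpace I x →L[ℝ] ℝ) (x₀ : M) (q : E) : E [⋀^Fin 1]→L[ℝ] ℝ :=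
  ContinuousAlternatingMap.ofSubsingleton ℝ E ℝ (0 : Fin 1)
    ((α ((extChartAt I x₀).symm q)).comp (mfderiv 𝓘(ℝ, E) I (extChartAt I x₀).symm q))

/-- The exterior derivative `dα` of a `1`-form on a manifold without boundary, with the
convention `dα(X, Y) = X(α(Y)) - Y(α(X)) - α([X, Y])`; it is computed in the preferred chart at the
point (for a smooth form every chart gives the same result). -/
def extDerivOne (α : ∀ x : M, TangentSpace I x →L[ℝ] ℝ) (x : M) (v w : TangentSpace I x) : ℝ :=
  extDeriv (formInChart I α x) (extChartAt I x x)
    ![mfderiv I 𝓘(ℝ, E) (extChartAt I x) x v, mfderiv I 𝓘(ℝ, E) (extChartAt I x) x w]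

/-- The vector field `X` is smooth on `U`. -/
def SmoothFieldOn (X : ∀ x : M, TangentSpace I x) [IsManifold I 1 M] (U : Set M) : Prop :=
  ContMDiffOn I I.tangent ∞ (fun x => (⟨x, X x⟩ : TangentBundle I M)) U

/-- The model fibre of the cotangent bundle. -/
abbrev CotangentFiber (E : Type*) [NormedAddCommGroup E] [NormedSpace ℝ E] : Type _ := E →L[ℝ] ℝ

variable (M) in
/-- The cotangent bundle `T*M`, with its manifold structure from Mathlib. -/
abbrev CotangentBundle [IsManifold I 1 M] : Type _ :=
  Bundle.TotalSpace (CotangentFiber E) (fun x : M => TangentSpace I x →L[ℝ] ℝ)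

/-- The model with corners of the cotangent bundle. -/
abbrev cotangentModel : ModelWithCorners ℝ (E × CotangentFiber E) (ModelProd H (CotangentFiber E)) :=
  I.prod 𝓘(ℝ, CotangentFiber E)

/-- The `1`-form `α` is smooth on `U`. -/
def SmoothFormOn (α : ∀ x : M, TangentSpace I x →L[ℝ] ℝ) [IsManifold I 1 M] (U : Set M) : Prop :=
  ContMDiffOn I (cotangentModel I) ∞ (fun x => (⟨x, α x⟩ : CotangentBundle I M)) U

end Forms

/-- The value of `β ∧ ⋯ ∧ β` (`n` factors) on `2n` vectors, for an alternating bilinear form `β`. -/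
def formPow {V : Type*} (n : ℕ) (β : V → V → ℝ) (v : Fin (2 * n) → V) : ℝ :=
  (1 / 2 ^ n : ℝ) * ∑ σ : Equiv.Perm (Fin (2 * n)), ((Equiv.Perm.sign σ : ℤ) : ℝ) *
    ∏ i : Fin n, β (v (σ ⟨2 * i, by omega⟩)) (v (σ ⟨2 * i + 1, by omega⟩))

/-- The value of `a ∧ β ∧ ⋯ ∧ β` (`n` factors `β`) on `2n + 1` vectors, for a linear form `a` and an
alternating bilinear form `β`. -/
def wedgeFormPow {V : Type*} (n : ℕ) (a : V → ℝ) (β : V → V → ℝ) (v : Fin (2 * n + 1) → V) : ℝ :=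
  (1 / 2 ^ n : ℝ) * ∑ σ : Equiv.Perm (Fin (2 * n + 1)), ((Equiv.Perm.sign σ : ℤ) : ℝ) *
    (a (v (σ ⟨0, by omega⟩)) *
      ∏ i : Fin n, β (v (σ ⟨2 * i + 1, by omega⟩)) (v (σ ⟨2 * i + 2, by omega⟩)))

/-! ### Hamiltonian mechanics on the cotangent bundle -/

section Hamiltonian

variable {E : Type*} [NormedAddCommGroup E] [NormedSpace ℝ E]
  {H : Type*} [TopologicalSpace H] (I : ModelWithCorners ℝ E H)
  {M : Type*} [TopologicalSpace M] [ChartedSpace H M] [IsManifold I 1 M]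

/-- The tautological (Liouville) `1`-form `p dx` on `T*M`: `λ_{(x, p)}(w) = p(dπ w)`. -/
def liouvilleForm (ζ : CotangentBundle I M) : TangentSpace (cotangentModel I) ζ →L[ℝ] ℝ :=
  ζ.2.comp (mfderiv (cotangentModel I) I (fun z : CotangentBundle I M => z.1) ζ)

/-- The standard symplectic form `Ω = dx ∧ dp = -d(p dx)` of `T*M`. -/
def symplecticForm (ζ : CotangentBundle I M) (v w : TangentSpace (cotangentModel I) ζ) : ℝ :=
  -extDerivOne (cotangentModel I) (liouvilleForm I) ζ v w

/-- The Hamiltonian vector field `sgrad F` of a function `F` on `T*M`: the field with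
`Ω(sgrad F, ·) = dF`. -/
def sgrad (F : CotangentBundle I M → ℝ) (ζ : CotangentBundle I M) :
    TangentSpace (cotangentModel I) ζ :=
  Classical.epsilon fun v : TangentSpace (cotangentModel I) ζ =>
    ∀ w, symplecticForm I ζ v w = mfderiv (cotangentModel I) 𝓘(ℝ, ℝ) F ζ w

/-- `J` is a first integral of the Hamiltonian flow of `F`: it is constant along every trajectory
of `sgrad F`, the flow being possibly incomplete. -/
def IsFirstIntegral (F J : CotangentBundle I M → ℝ) : Prop :=
  ∀ (γ : ℝ → CotangentBundle I M) (a b : ℝ),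
    IsMIntegralCurveOn (I := cotangentModel I) γ (sgrad I F) (Set.Ioo a b) →
    ∀ s ∈ Set.Ioo a b, ∀ t ∈ Set.Ioo a b, J (γ s) = J (γ t)

end Hamiltonian

/-! ### Contact sub-Riemannian structures -/

/-- A contact sub-Riemannian structure `(Π, g)` on a smooth manifold `M` of dimension `2n + 1`:
`plane` is the distribution `Π` and `metric` is the metric `g` on it. -/
structure ContactSubRiemannian (n : ℕ) (M : Type*) [TopologicalSpace M]
    [ChartedSpace (EuclideanSpace ℝ (Fin (2 * n + 1))) M] [IsManifold (𝓡 (2 * n + 1)) ∞ M] where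
  /-- The distribution. -/
  plane : ∀ x : M, Submodule ℝ (TangentSpace (𝓡 (2 * n + 1)) x)
  /-- It has rank `2n`. -/
  finrank_plane : ∀ x, Module.finrank ℝ (plane x) = 2 * n
  /-- It is a smooth subbundle: near each point it has a smooth frame. -/
  exists_frame : ∀ x₀ : M, ∃ U : Set M, IsOpen U ∧ x₀ ∈ U ∧
    ∃ ξ : Fin (2 * n) → ∀ x : M, plane x,
      (∀ i, SmoothFieldOn (𝓡 (2 * n + 1)) (fun x => (ξ i x : TangentSpace (𝓡 (2 * n + 1)) x)) U) ∧
      ∀ x ∈ U, LinearIndependent ℝ (fun i => ξ i x)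
  /-- It is contact: `α ∧ (dα)ⁿ ≠ 0` for every nowhere zero local section `α` of its annihilator. -/
  contact : ∀ (U : Set M) (α : ∀ x : M, TangentSpace (𝓡 (2 * n + 1)) x →L[ℝ] ℝ), IsOpen U →
    SmoothFormOn (𝓡 (2 * n + 1)) α U → (∀ x ∈ U, α x ≠ 0 ∧ ∀ v ∈ plane x, α x v = 0) →
    ∀ x ∈ U, ∃ v : Fin (2 * n + 1) → TangentSpace (𝓡 (2 * n + 1)) x,
      wedgeFormPow n (fun u => α x u) (extDerivOne (𝓡 (2 * n + 1)) α x) v ≠ 0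
  /-- The metric on the distribution. -/
  metric : ∀ x : M, LinearMap.BilinForm ℝ (plane x)
  metric_symm : ∀ (x : M) (u v : plane x), metric x u v = metric x v u
  metric_pos : ∀ (x : M) (u : plane x), u ≠ 0 → 0 < metric x u u
  /-- The metric is smooth: it is smooth on smooth local sections of the distribution. -/
  metric_smooth : ∀ (U : Set M) (X Y : ∀ x : M, plane x), IsOpen U →
    SmoothFieldOn (𝓡 (2 * n + 1)) (fun x => (X x : TangentSpace (𝓡 (2 * n + 1)) x)) U →
    SmoothFieldOn (𝓡 (2 * n + 1)) (fun x => (Y x : TangentSpace (𝓡 (2 * n + 1)) x)) U →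
    ContMDiffOn (𝓡 (2 * n + 1)) 𝓘(ℝ, ℝ) ∞ (fun x => metric x (X x) (Y x)) U

namespace ContactSubRiemannian

variable {n : ℕ} {M : Type*} [TopologicalSpace M]
  [ChartedSpace (EuclideanSpace ℝ (Fin (2 * n + 1))) M] [IsManifold (𝓡 (2 * n + 1)) ∞ M]
  (S : ContactSubRiemannian n M)

instance instFiniteDimensionalPlane (x : M) : FiniteDimensional ℝ (S.plane x) :=
  haveI : FiniteDimensional ℝ (TangentSpace (𝓡 (2 * n + 1)) x) :=
    inferInstanceAs (FiniteDimensional ℝ (EuclideanSpace ℝ (Fin (2 * n + 1))))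
  inferInstance

theorem metric_nondegenerate (x : M) : (S.metric x).Nondegenerate := by
  constructor
  · intro u hu
    by_contra h
    exact (S.metric_pos x u h).ne' (hu u)
  · intro u hu
    by_contra h
    exact (S.metric_pos x u h).ne' (hu u)

/-- The map `T*M → Π* → Π`: restrict a covector `p` to `Π` and raise the index with `g`, so that
`g(sharp p, w) = p(w)` for `w ∈ Π`. -/
def sharp (x : M) (p : TangentSpace (𝓡 (2 * n + 1)) x →L[ℝ] ℝ) : S.plane x :=
  ((S.metric x).toDual (S.metric_nondegenerate x)).symm
    (p.toLinearMap.comp (S.plane x).subtype)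

/-- The Hamiltonian of the sub-Riemannian geodesic flow, `H(p) = ½ ‖sharp p‖²`. -/
def hamiltonian (ζ : CotangentBundle (𝓡 (2 * n + 1)) M) : ℝ :=
  (1 / 2) * S.metric ζ.1 (S.sharp ζ.1 ζ.2) (S.sharp ζ.1 ζ.2)

/-- `α` is a contact form of `Π` on the open set `U`, normalized by `(dα)ⁿ|_Π = ± vol_g`, that is,
`(dα)ⁿ` takes the values `± 1` on `g`-orthonormal frames of `Π`. -/
def IsNormalizedContactForm (U : Set M) (α : ∀ x : M, TangentSpace (𝓡 (2 * n + 1)) x →L[ℝ] ℝ) :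
    Prop :=
  IsOpen U ∧ SmoothFormOn (𝓡 (2 * n + 1)) α U ∧
    ∀ x ∈ U, (∀ v : TangentSpace (𝓡 (2 * n + 1)) x, v ∈ S.plane x ↔ α x v = 0) ∧
      ∀ e : Fin (2 * n) → S.plane x,
        (∀ i j, S.metric x (e i) (e j) = if i = j then 1 else 0) →
        |formPow n (fun u w : S.plane x => extDerivOne (𝓡 (2 * n + 1)) α x u w) e| = 1

/-- `v` is the value at `x` of the Reeb field of the contact form `α`: `α(v) = 1`, `dα(v, ·) = 0`. -/
def IsReebVectorOf (α : ∀ x : M, TangentSpace (𝓡 (2 * n + 1)) x →L[ℝ] ℝ) (x : M)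
    (v : TangentSpace (𝓡 (2 * n + 1)) x) : Prop :=
  α x v = 1 ∧ ∀ w, extDerivOne (𝓡 (2 * n + 1)) α x v w = 0

/-- `v` is the value at `x` of the Reeb field of some normalized contact form of `Π` near `x`; this
determines `v` up to sign. -/
def IsReebVector (x : M) (v : TangentSpace (𝓡 (2 * n + 1)) x) : Prop :=
  ∃ (U : Set M) (α : ∀ x : M, TangentSpace (𝓡 (2 * n + 1)) x →L[ℝ] ℝ),
    x ∈ U ∧ S.IsNormalizedContactForm U α ∧ IsReebVectorOf α x v

/-- The Reeb momentum `I_g(p) = ⟨p, ν_α⟩²` on `T*M`; the square does not depend on the sign of the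
Reeb vector `ν_α`. -/
def reebMomentum (ζ : CotangentBundle (𝓡 (2 * n + 1)) M) : ℝ :=
  (ζ.2 (Classical.epsilon (S.IsReebVector ζ.1))) ^ 2

/-- The structure is Reeb-symmetric: `L_ν g = 0` on `Π` for the (local) Reeb fields `ν`, that is,
for all smooth local sections `X`, `Y` of `Π` the brackets `[ν, X]`, `[ν, Y]` are tangent to `Π` and
`(L_ν g)(X, Y) = ν(g(X, Y)) - g([ν, X], Y) - g(X, [ν, Y])` vanishes. -/
def ReebSymmetric : Prop :=
  ∀ (U : Set M) (α : ∀ x : M, TangentSpace (𝓡 (2 * n + 1)) x →L[ℝ] ℝ)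
    (ν : ∀ x : M, TangentSpace (𝓡 (2 * n + 1)) x),
    S.IsNormalizedContactForm U α → (∀ x ∈ U, IsReebVectorOf α x (ν x)) →
    ∀ X Y : ∀ x : M, S.plane x,
      SmoothFieldOn (𝓡 (2 * n + 1)) (fun x => (X x : TangentSpace (𝓡 (2 * n + 1)) x)) U →
      SmoothFieldOn (𝓡 (2 * n + 1)) (fun x => (Y x : TangentSpace (𝓡 (2 * n + 1)) x)) U →
      ∀ x ∈ U,
        ∃ (hX : VectorField.mlieBracket (𝓡 (2 * n + 1)) ν
            (fun y => (X y : TangentSpace (𝓡 (2 * n + 1)) y)) x ∈ S.plane x)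
          (hY : VectorField.mlieBracket (𝓡 (2 * n + 1)) ν
            (fun y => (Y y : TangentSpace (𝓡 (2 * n + 1)) y)) x ∈ S.plane x),
          S.metric x ⟨_, hX⟩ (Y x) + S.metric x (X x) ⟨_, hY⟩ =
            mfderiv (𝓡 (2 * n + 1)) 𝓘(ℝ, ℝ) (fun y => S.metric y (X y) (Y y)) x (ν x)

end ContactSubRiemannian

end ContactSR

end

open scoped Manifold ContDiff
open Set Filter Topology VectorField

noncomputable section

/-! Near a point choose a normalized contact form with Reeb field ν, and for a vector field X write
P_X(p) = p(X), so that I_g = P_ν². Everything reduces to one identity. Let ζ = (x, p) and let Y be a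
local section of Π with Y(x) = `sharp` p. Then the derivative of I_g at ζ along `sgrad` H is P_ν ·
(ν(g(Y, Y)) - 2 g(Y, [ν, Y])) = P_ν · (L_ν g)(Y, Y) (`differential_reebMomentum_sgrad`).

The identity has three ingredients. Completing the square gives H ≥ P_Y - g(Y, Y)/2 with equality at
ζ, so both sides have the same differential there (`differential_hamiltonian`). The Poisson bracket
of P_ν and P_Y is the momentum of the Lie bracket (`differential_momentum_cotangentLift`), and the
Hamiltonian field of P_ν projects to ν (`differential_comp_proj`). Finally [ν, Y] is tangent to Π by
Cartan's formula, so p([ν, Y]) = g(Y, [ν, Y]).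

If L_ν g = 0 the derivative vanishes identically. Conversely, the values p(ν) and `sharp` p can be
prescribed independently (`exists_covector`). Taking p(ν) = 1 shows that the quadratic form of L_ν g
vanishes, and polarization finishes.

Two supports are needed. First, being a first integral must be equivalent to dI_g(`sgrad` H) = 0
(`isFirstIntegral_iff`), which requires `sgrad` H to be smooth so that trajectories exist. Second,
I_g must be smooth: normalized contact forms exist locally (`exists_isNormalizedContactForm`), their
Reeb fields are smooth (`smooth_reeb`), and they are unique up to sign
(`IsReebVector.eq_or_eq_neg`). -/

namespace ContactSR

/-! ### Forms, fields and Cartan's formula in the preferred chart. -/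

section General

variable {E : Type*} [NormedAddCommGroup E] [NormedSpace ℝ E]
  {H : Type*} [TopologicalSpace H] {I : ModelWithCorners ℝ E H}
  {M : Type*} [TopologicalSpace M] [ChartedSpace H M]

/-- The identification of a tangent space with the model space, by the preferred chart. -/
def modelEquiv (I : ModelWithCorners ℝ E H) (x : M) : TangentSpace I x ≃L[ℝ] E :=
  ContinuousLinearEquiv.refl ℝ E

/-- The differential of a function, as a linear form. -/
def differential (I : ModelWithCorners ℝ E H) (f : M → ℝ) (x : M) : TangentSpace I x →L[ℝ] ℝ :=
  mfderiv I 𝓘(ℝ, ℝ) f x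

/-- The coordinate expression of a `1`-form in the preferred chart at `x₀`, as a map into the dual
of the model space. -/
def chartForm (I : ModelWithCorners ℝ E H) (α : ∀ x : M, TangentSpace I x →L[ℝ] ℝ) (x₀ : M)
    (q : E) : E →L[ℝ] ℝ :=
  (α ((extChartAt I x₀).symm q)).comp (mfderiv 𝓘(ℝ, E) I (extChartAt I x₀).symm q)

/-- The coordinate expression of a vector field in the preferred chart at `x₀`. -/
def chartField (I : ModelWithCorners ℝ E H) (X : ∀ x : M, TangentSpace I x) (x₀ : M)
    (q : E) : E :=
  mpullbackWithin 𝓘(ℝ, E) I (extChartAt I x₀).symm X (range I) q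

theorem mfderiv_extChartAt_apply [IsManifold I 1 M] (x : M) (v : TangentSpace I x) :
    mfderiv I 𝓘(ℝ, E) (extChartAt I x) x v = modelEquiv I x v := by
  rw [mfderiv_extChartAt_self]
  rfl

/-- In degree one the alternating sum defining `extDeriv` has two terms, so dα is the
antisymmetrized derivative of the coordinate covector. The derivative of the preferred chart at its
own base point is the identity, hence no chart derivative is left. -/
theorem extDerivOne_eq_fderiv_chartForm [IsManifold I 1 M]
    {α : ∀ x : M, TangentSpace I x →L[ℝ] ℝ} {x : M}
    (hα : DifferentiableAt ℝ (chartForm I α x) (extChartAt I x x)) (v w : TangentSpace I x) :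
    extDerivOne I α x v w =
      fderiv ℝ (chartForm I α x) (extChartAt I x x) (modelEquiv I x v) (modelEquiv I x w) -
        fderiv ℝ (chartForm I α x) (extChartAt I x x) (modelEquiv I x w) (modelEquiv I x v) := by
  have h1 : formInChart I α x = fun q =>
      ContinuousAlternatingMap.ofSubsingletonLIE (𝕜 := ℝ) (E := E) (F := ℝ) (0 : Fin 1)
        (chartForm I α x q) := rfl
  have hd : DifferentiableAt ℝ (formInChart I α x) (extChartAt I x x) := by
    rw [h1]
    exact (ContinuousAlternatingMap.ofSubsingletonLIE (𝕜 := ℝ) (E := E) (F := ℝ)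
      (0 : Fin 1)).toContinuousLinearEquiv.differentiableAt.comp _ hα
  have key : ∀ u w : E, fderiv ℝ (fun q => chartForm I α x q u) (extChartAt I x x) w =
      fderiv ℝ (chartForm I α x) (extChartAt I x x) w u := by
    intro u w
    rw [fderiv_clm_apply hα (differentiableAt_const u)]
    simp
  have h2 : extDerivOne I α x v w = extDeriv (formInChart I α x) (extChartAt I x x)
      ![modelEquiv I x v, modelEquiv I x w] := by
    unfold extDerivOne
    rw [mfderiv_extChartAt_apply, mfderiv_extChartAt_apply]
  rw [h2, extDeriv_apply hd, Fin.sum_univ_two, ← key, ← key]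
  simp [Fin.removeNth, formInChart, chartForm, sub_eq_add_neg]

/-- The differential of a function which is `g` in the chart at `x`. -/
theorem hasMFDerivAt_of_eventuallyEq_chart [IsManifold I 1 M] {f : M → ℝ} {g : E → ℝ} {x : M}
    (hg : DifferentiableAt ℝ g (extChartAt I x x))
    (h : f =ᶠ[𝓝 x] fun y => g (extChartAt I x y)) :
    HasMFDerivAt I 𝓘(ℝ, ℝ) f x
      ((fderiv ℝ g (extChartAt I x x)).comp (mfderiv I 𝓘(ℝ, E) (extChartAt I x) x)) := by
  have h1 : HasMFDerivAt 𝓘(ℝ, E) 𝓘(ℝ, ℝ) g (extChartAt I x x) (fderiv ℝ g (extChartAt I x x)) :=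
    hg.hasFDerivAt.hasMFDerivAt
  have h2 : HasMFDerivAt I 𝓘(ℝ, E) (extChartAt I x) x (mfderiv I 𝓘(ℝ, E) (extChartAt I x) x) :=
    (mdifferentiableAt_extChartAt (mem_chart_source H x)).hasMFDerivAt
  exact (HasMFDerivAt.comp x h1 h2).congr_of_eventuallyEq h

theorem differential_of_eventuallyEq_chart [IsManifold I 1 M] {f : M → ℝ} {g : E → ℝ} {x : M}
    (hg : DifferentiableAt ℝ g (extChartAt I x x))
    (h : f =ᶠ[𝓝 x] fun y => g (extChartAt I x y)) (v : TangentSpace I x) :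
    differential I f x v = fderiv ℝ g (extChartAt I x x) (modelEquiv I x v) := by
  unfold differential
  rw [(hasMFDerivAt_of_eventuallyEq_chart hg h).mfderiv]
  exact congrArg (fderiv ℝ g (extChartAt I x x)) (mfderiv_extChartAt_apply x v)

theorem chartField_self [IsManifold I 1 M] (X : ∀ x : M, TangentSpace I x) (x : M) :
    chartField I X x (extChartAt I x x) = modelEquiv I x (X x) := by
  unfold chartField
  rw [mpullbackWithin_apply, mfderivWithin_range_extChartAt_symm]
  have := congrArg (fun y => (X y : E)) (extChartAt_to_inv (I := I) x)
  refine Eq.trans ?_ this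
  exact congrFun (congrArg DFunLike.coe (ContinuousLinearMap.inverse_id (R := ℝ) (M := E))) _

variable [I.Boundaryless]

/-- The covector is composed with the derivative of the inverse chart and the vector with its
inverse, so the two cancel. One side uses `mfderiv` and the other `mfderivWithin` on `range I`; they
agree because there is no boundary. -/
theorem chartForm_apply_chartField [IsManifold I 1 M] [CompleteSpace E]
    (α : ∀ x : M, TangentSpace I x →L[ℝ] ℝ)
    (X : ∀ x : M, TangentSpace I x) {x : M} {q : E} (hq : q ∈ (extChartAt I x).target) :
    chartForm I α x q (chartField I X x q) =
      α ((extChartAt I x).symm q) (X ((extChartAt I x).symm q)) := by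
  obtain ⟨e, he⟩ := isInvertible_mfderivWithin_extChartAt_symm (I := I) hq
  unfold chartForm chartField
  rw [mpullbackWithin_apply, ← mfderivWithin_univ, ← I.range_eq_univ, ← he]
  rw [ContinuousLinearMap.inverse_equiv]
  exact congrArg (α ((extChartAt I x).symm q)) (e.apply_symm_apply _)

theorem eventually_chartForm_apply [IsManifold I 1 M] [CompleteSpace E]
    (α : ∀ x : M, TangentSpace I x →L[ℝ] ℝ) (X : ∀ x : M, TangentSpace I x) (x : M) :
    (fun y => α y (X y)) =ᶠ[𝓝 x] fun y => (fun q => chartForm I α x q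
      (chartField I X x q)) (extChartAt I x y) := by
  filter_upwards [extChartAt_source_mem_nhds (I := I) x] with y hy
  rw [chartForm_apply_chartField α X ((extChartAt I x).map_source hy),
    (extChartAt I x).left_inv hy]

theorem differentiableAt_chartField [IsManifold I 2 M] [CompleteSpace E] [IsManifold I 1 M]
    {X : ∀ x : M, TangentSpace I x} {x : M}
    (hX : MDifferentiableAt I I.tangent (fun y => (⟨y, X y⟩ : TangentBundle I M)) x) :
    DifferentiableAt ℝ (chartField I X x) (extChartAt I x x) := by
  have h := MDifferentiableWithinAt.differentiableWithinAt_mpullbackWithin_vectorField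
    (s := univ) hX.mdifferentiableWithinAt
  rw [preimage_univ, univ_inter] at h
  exact h.differentiableAt (by rw [I.range_eq_univ]; exact univ_mem)

theorem chartForm_self [IsManifold I 1 M] (α : ∀ x : M, TangentSpace I x →L[ℝ] ℝ) (x : M)
    (v : TangentSpace I x) :
    chartForm I α x (extChartAt I x x) (modelEquiv I x v) = α x v := by
  unfold chartForm
  rw [← mfderivWithin_univ, ← I.range_eq_univ, mfderivWithin_range_extChartAt_symm]
  exact congrArg (fun y => (show E →L[ℝ] ℝ from α y) v) (extChartAt_to_inv (I := I) x)

theorem modelEquiv_mlieBracket [IsManifold I 1 M] (X Y : ∀ x : M, TangentSpace I x)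
    (x : M) :
    modelEquiv I x (mlieBracket I X Y x) =
      lieBracket ℝ (chartField I X x) (chartField I Y x) (extChartAt I x x) := by
  rw [← mlieBracketWithin_univ, mlieBracketWithin_apply, mfderiv_extChartAt_self,
    preimage_univ, univ_inter, ← lieBracketWithin_univ, ← I.range_eq_univ]
  exact congrFun (congrArg DFunLike.coe (ContinuousLinearMap.inverse_id (R := ℝ) (M := E))) _

/-- Cartan's formula `dα(X, Y) = X(α(Y)) - Y(α(X)) - α([X, Y])`. -/
theorem extDerivOne_apply_fields [IsManifold I 2 M] [CompleteSpace E]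
    {α : ∀ x : M, TangentSpace I x →L[ℝ] ℝ} {x : M} [IsManifold I 1 M]
    (hα : DifferentiableAt ℝ (chartForm I α x) (extChartAt I x x))
    {X Y : ∀ x : M, TangentSpace I x}
    (hX : MDifferentiableAt I I.tangent (fun y => (⟨y, X y⟩ : TangentBundle I M)) x)
    (hY : MDifferentiableAt I I.tangent (fun y => (⟨y, Y y⟩ : TangentBundle I M)) x) :
    extDerivOne I α x (X x) (Y x) =
      differential I (fun y => α y (Y y)) x (X x) -
        differential I (fun y => α y (X y)) x (Y x) - α x (mlieBracket I X Y x) := by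
  have dX := differentiableAt_chartField hX
  have dY := differentiableAt_chartField hY
  -- The product rule for α(Y) and α(X) in the chart leaves, besides the antisymmetrized derivative
  -- of α, the terms α(DY·X) - α(DX·Y), which are exactly α([X, Y]).
  rw [extDerivOne_eq_fderiv_chartForm hα,
    differential_of_eventuallyEq_chart (hα.clm_apply dY) (eventually_chartForm_apply α Y x),
    differential_of_eventuallyEq_chart (hα.clm_apply dX) (eventually_chartForm_apply α X x),
    ← chartForm_self α x, modelEquiv_mlieBracket, fderiv_clm_apply hα dX,
    fderiv_clm_apply hα dY, lieBracket]
  simp only [chartField_self, map_sub, add_apply,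
    ContinuousLinearMap.comp_apply, ContinuousLinearMap.flip_apply]
  ring

end General

/-! ### Smooth dependence of determinants and inverse matrices. -/

section Matrices

variable {E : Type*} [NormedAddCommGroup E] [NormedSpace ℝ E]
  {H : Type*} [TopologicalSpace H] {I : ModelWithCorners ℝ E H}
  {M : Type*} [TopologicalSpace M] [ChartedSpace H M]

theorem contMDiffAt_det {ι : Type*} [Fintype ι] [DecidableEq ι] {A : M → Matrix ι ι ℝ} {x : M}
    (h : ∀ i j, ContMDiffAt I 𝓘(ℝ, ℝ) ∞ (fun y => A y i j) x) :
    ContMDiffAt I 𝓘(ℝ, ℝ) ∞ (fun y => (A y).det) x := by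
  simp only [Matrix.det_apply']
  refine ContMDiffAt.sum fun σ _ => ContMDiffAt.mul contMDiffAt_const ?_
  exact ContMDiffAt.prod fun i _ => h _ _

/-- Cramer's rule: an entry of the adjugate is the determinant of the matrix with one row replaced
by a constant unit vector. -/
theorem contMDiffAt_inv_apply {ι : Type*} [Fintype ι] [DecidableEq ι] {A : M → Matrix ι ι ℝ}
    {x : M} (h : ∀ i j, ContMDiffAt I 𝓘(ℝ, ℝ) ∞ (fun y => A y i j) x) (hx : (A x).det ≠ 0) (i j : ι) :
    ContMDiffAt I 𝓘(ℝ, ℝ) ∞ (fun y => (A y)⁻¹ i j) x := by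
  simp only [Matrix.inv_def, Matrix.smul_apply, Matrix.adjugate_apply, Ring.inverse_eq_inv',
    smul_eq_mul]
  refine ContMDiffAt.mul ?_ (contMDiffAt_det fun k l => ?_)
  · exact (contMDiffAt_det h).inv₀ hx
  · by_cases hk : k = j
    · subst hk
      simpa using contMDiffAt_const
    · simpa [Matrix.updateRow_ne hk] using h k l

end Matrices

/-! ### Smoothness of forms, of exterior derivatives and of solutions of linear systems. -/

section Smoothness

variable {E : Type*} [NormedAddCommGroup E] [NormedSpace ℝ E]
  {H : Type*} [TopologicalSpace H] {I : ModelWithCorners ℝ E H}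
  {M : Type*} [TopologicalSpace M] [ChartedSpace H M] [IsManifold I ∞ M]

/-- The inverse of the tangent bundle trivialization is the derivative of the inverse chart. This
links smoothness as a section of T*M with differentiability of the coordinate expression that
`extDeriv` acts on. -/
theorem inCoordinates_eq_chartForm [I.Boundaryless] (α : ∀ x : M, TangentSpace I x →L[ℝ] ℝ) {x y : M}
    (hy : y ∈ (chartAt H x).source) :
    ContinuousLinearMap.inCoordinates E (TangentSpace I) ℝ (fun _ : M => ℝ) x y x y (α y) =
      chartForm I α x (extChartAt I x y) := by
  have hy' : y ∈ (extChartAt I x).source := by rwa [extChartAt_source]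
  have h1 := TangentBundle.symmL_trivializationAt (I := I) hy
  have e1 : (extChartAt I x).symm (extChartAt I x y) = y := (extChartAt I x).left_inv hy'
  ext v
  unfold chartForm
  rw [← mfderivWithin_univ, ← I.range_eq_univ, ← h1]
  have h2 : ContinuousLinearMap.inCoordinates E (TangentSpace I) ℝ (fun _ : M => ℝ) x y x y (α y) v
      = (α y) ((trivializationAt E (TangentSpace I) x).symmL ℝ y v) := by
    simp [ContinuousLinearMap.inCoordinates]
  rw [h2]
  exact congrArg (fun z => (show E →L[ℝ] ℝ from α z)
    ((trivializationAt E (TangentSpace I) x).symmL ℝ y v)) e1.symm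

theorem contMDiffAt_form_iff [I.Boundaryless] (α : ∀ x : M, TangentSpace I x →L[ℝ] ℝ) (x : M) :
    ContMDiffAt I (cotangentModel I) ∞ (fun x => (⟨x, α x⟩ : CotangentBundle I M)) x ↔
      ContDiffAt ℝ ∞ (chartForm I α x) (extChartAt I x x) := by
  have h1 : ContMDiffAt I (cotangentModel I) ∞ (fun x => (⟨x, α x⟩ : CotangentBundle I M)) x ↔
    ContMDiffAt I 𝓘(ℝ, E →L[ℝ] ℝ) ∞ (fun y => chartForm I α x (extChartAt I x y)) x := by
    refine (contMDiffAt_hom_bundle (fun x => (⟨x, α x⟩ : CotangentBundle I M))).trans ?_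
    have : (fun y => ContinuousLinearMap.inCoordinates E (TangentSpace I) ℝ (fun _ : M => ℝ) x y x y
      (α y)) =ᶠ[𝓝 x] (fun y => chartForm I α x (extChartAt I x y)) := by
      filter_upwards [chart_source_mem_nhds H x] with y hy
      exact inCoordinates_eq_chartForm α hy
    constructor
    · intro h
      exact h.2.congr_of_eventuallyEq this.symm
    · intro h
      exact ⟨contMDiffAt_id, h.congr_of_eventuallyEq this⟩
  rw [h1]
  constructor
  · intro h
    have h2 : ContMDiffAt 𝓘(ℝ, E) I ∞ (extChartAt I x).symm (extChartAt I x x) := by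
      have := contMDiffWithinAt_extChartAt_symm_range (I := I) (n := ∞) x (mem_extChartAt_target x)
      rwa [I.range_eq_univ, contMDiffWithinAt_univ] at this
    have h3 : ContMDiffAt 𝓘(ℝ, E) 𝓘(ℝ, E →L[ℝ] ℝ) ∞
        ((fun y => chartForm I α x (extChartAt I x y)) ∘ (extChartAt I x).symm)
        (extChartAt I x x) := by
      apply ContMDiffAt.comp _ _ h2
      rwa [extChartAt_to_inv]
    refine h3.contDiffAt.congr_of_eventuallyEq ?_
    filter_upwards [extChartAt_target_mem_nhds (I := I) x] with q hq
    simp only [Function.comp_apply]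
    rw [(extChartAt I x).right_inv hq]
  · intro h
    exact ContMDiffAt.comp x h.contMDiffAt contMDiffAt_extChartAt

theorem smoothFormOn_iff [I.Boundaryless] {α : ∀ x : M, TangentSpace I x →L[ℝ] ℝ} {U : Set M}
    (hU : IsOpen U) :
    SmoothFormOn I α U ↔ ∀ x ∈ U, ContDiffAt ℝ ∞ (chartForm I α x) (extChartAt I x x) := by
  simp only [← contMDiffAt_form_iff]
  exact ⟨fun h x hx => h.contMDiffAt (hU.mem_nhds hx), fun h x hx => (h x hx).contMDiffWithinAt⟩

theorem SmoothFormOn.differentiableAt [I.Boundaryless] {α : ∀ x : M, TangentSpace I x →L[ℝ] ℝ}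
    {U : Set M} (h : SmoothFormOn I α U) (hU : IsOpen U) {x : M} (hx : x ∈ U) :
    DifferentiableAt ℝ (chartForm I α x) (extChartAt I x x) :=
  ((smoothFormOn_iff hU).1 h x hx).differentiableAt (by simp)

theorem SmoothFormOn.apply {α : ∀ x : M, TangentSpace I x →L[ℝ] ℝ} {U : Set M}
    (h : SmoothFormOn I α U) {X : ∀ x : M, TangentSpace I x} (hX : SmoothFieldOn I X U) :
    ContMDiffOn I 𝓘(ℝ, ℝ) ∞ (fun x => α x (X x)) U := by
  have := ContMDiffOn.clm_bundle_apply (E₂ := fun _ : M => ℝ) (F₂ := ℝ) h hX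
  intro x hx
  exact (Bundle.contMDiffWithinAt_totalSpace.1 (this x hx)).2

/-- The function df(X) is the fibre component of the tangent map of f composed with the section X.
-/
theorem SmoothFieldOn.differential {f : M → ℝ} {U : Set M} (hU : IsOpen U)
    (hf : ContMDiffOn I 𝓘(ℝ, ℝ) ∞ f U) {X : ∀ x : M, TangentSpace I x}
    (hX : SmoothFieldOn I X U) :
    ContMDiffOn I 𝓘(ℝ, ℝ) ∞ (fun x => ContactSR.differential I f x (X x)) U := by
  have h1 := hf.contMDiffOn_tangentMapWithin (m := ∞) (by simp) hU.uniqueMDiffOn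
  have h2 := h1.comp hX (fun x hx => hx)
  have h3 := (contMDiff_snd_tangentBundle_modelSpace ℝ 𝓘(ℝ, ℝ) (n := ∞)).comp_contMDiffOn h2
  refine h3.congr fun x hx => ?_
  have h4 := mfderivWithin_of_isOpen (I := I) (I' := 𝓘(ℝ, ℝ)) (f := f) hU hx
  exact (congrArg (fun L : TangentSpace I x →L[ℝ] ℝ => L (X x)) h4).symm

theorem SmoothFieldOn.mdifferentiableAt {X : ∀ x : M, TangentSpace I x} {U : Set M}
    (hX : SmoothFieldOn I X U) (hU : IsOpen U) {x : M} (hx : x ∈ U) :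
    MDifferentiableAt I I.tangent (fun y => (⟨y, X y⟩ : TangentBundle I M)) x :=
  (hX.contMDiffAt (hU.mem_nhds hx)).mdifferentiableAt (by simp)

theorem SmoothFieldOn.mlieBracket [CompleteSpace E] {X Y : ∀ x : M, TangentSpace I x} {U : Set M}
    (hX : SmoothFieldOn I X U) (hY : SmoothFieldOn I Y U) (hU : IsOpen U) :
    SmoothFieldOn I (VectorField.mlieBracket I X Y) U := by
  intro x hx
  have : IsManifold I (((⊤ : ℕ∞) : WithTop ℕ∞) + 1) M := inferInstanceAs (IsManifold I ∞ M)
  have : IsManifold I (minSmoothness ℝ 2) M := by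
    rw [minSmoothness_of_isRCLikeNormedField]
    infer_instance
  refine (ContMDiffAt.mlieBracket_vectorField (m := ⊤) (n := ⊤)
    (hX.contMDiffAt (hU.mem_nhds hx)) (hY.contMDiffAt (hU.mem_nhds hx)) ?_).contMDiffWithinAt
  simp

/-- The exterior derivative of a smooth form is smooth. -/
theorem SmoothFormOn.extDerivOne [I.Boundaryless] [CompleteSpace E]
    {α : ∀ x : M, TangentSpace I x →L[ℝ] ℝ} {U : Set M} (h : SmoothFormOn I α U) (hU : IsOpen U)
    {X Y : ∀ x : M, TangentSpace I x} (hX : SmoothFieldOn I X U) (hY : SmoothFieldOn I Y U) :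
    ContMDiffOn I 𝓘(ℝ, ℝ) ∞ (fun x => ContactSR.extDerivOne I α x (X x) (Y x)) U := by
  -- `extDerivOne` uses a different chart at each point, so its smoothness cannot be read off the
  -- definition. Cartan's formula rewrites it through derivatives and brackets that do not refer to
  -- a chart.
  have h1 := hX.differential hU (h.apply hY)
  have h2 := hY.differential hU (h.apply hX)
  have h3 := h.apply (hX.mlieBracket hY hU)
  refine ((h1.sub h2).sub h3).congr fun x hx => ?_
  rw [extDerivOne_apply_fields (h.differentiableAt hU hx) (hX.mdifferentiableAt hU hx)
    (hY.mdifferentiableAt hU hx)]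

variable [FiniteDimensional ℝ E]

/-- The solution `v` of a nondegenerate linear system `B(v, ·) = θ` with smooth coefficients is a
smooth vector field. -/
theorem smoothFieldOn_of_bilin [I.Boundaryless] {U : Set M} (hU : IsOpen U)
    {B : ∀ x : M, TangentSpace I x →ₗ[ℝ] TangentSpace I x →ₗ[ℝ] ℝ}
    (hB : ∀ x ∈ U, ∀ v, (∀ w, B x v w = 0) → v = 0)
    (hsB : ∀ (V : Set M) (X Y : ∀ x : M, TangentSpace I x), IsOpen V → V ⊆ U →
      SmoothFieldOn I X V → SmoothFieldOn I Y V →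
      ContMDiffOn I 𝓘(ℝ, ℝ) ∞ (fun x => B x (X x) (Y x)) V)
    {θ : ∀ x : M, TangentSpace I x →ₗ[ℝ] ℝ}
    (hsθ : ∀ (V : Set M) (Y : ∀ x : M, TangentSpace I x), IsOpen V → V ⊆ U → SmoothFieldOn I Y V →
      ContMDiffOn I 𝓘(ℝ, ℝ) ∞ (fun x => θ x (Y x)) V)
    {v : ∀ x : M, TangentSpace I x} (hv : ∀ x ∈ U, ∀ w, B x (v x) w = θ x w) :
    SmoothFieldOn I v U := by
  intro x₀ hx₀
  let b := Module.finBasis ℝ E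
  let e := trivializationAt E (TangentSpace I) x₀
  have hfr := e.isLocalFrameOn_localFrame_baseSet I ∞ b
  set V := U ∩ e.baseSet with hV
  have hVo : IsOpen V := hU.inter e.open_baseSet
  have hxe : x₀ ∈ e.baseSet := FiberBundle.mem_baseSet_trivializationAt' x₀
  have hxV : x₀ ∈ V := ⟨hx₀, hxe⟩
  have hW : ∀ i, SmoothFieldOn I (e.localFrame b i) V := fun i =>
    (hfr.contMDiffOn i).mono inter_subset_right
  -- The indices are ordered so that the frame coefficients c of v solve A c = θ(frame). Then c =
  -- A⁻¹ θ(frame) is smooth by Cramer's rule.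
  let A : M → Matrix _ _ ℝ := fun x => Matrix.of fun k j => B x (e.localFrame b j x) (e.localFrame b k x)
  have hdet : ∀ x ∈ V, (A x).det ≠ 0 := by
    intro x hx h0
    obtain ⟨c, hc, hc0⟩ := Matrix.exists_mulVec_eq_zero_iff.2 h0
    apply hc
    have hli := hfr.linearIndependent hx.2
    have hz : ∑ j, c j • e.localFrame b j x = 0 := by
      apply hB x hx.1
      intro w
      have hw : ∀ k, B x (∑ j, c j • e.localFrame b j x) (e.localFrame b k x) = 0 := by
        intro k
        have := congrFun hc0 k
        simp only [Matrix.mulVec, dotProduct, A, Matrix.of_apply, Pi.zero_apply] at this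
        rw [map_sum, LinearMap.sum_apply, ← this]
        refine Finset.sum_congr rfl fun j _ => ?_
        simp [mul_comm]
      have hzero : B x (∑ j, c j • e.localFrame b j x) = 0 := by
        apply (hfr.toBasisAt hx.2).ext
        intro k
        rw [IsLocalFrameOn.toBasisAt_coe, hw]
        rfl
      rw [hzero]; rfl
    funext j
    exact Fintype.linearIndependent_iff.1 hli c hz j
  have hcoef : ∀ i, ContMDiffAt I 𝓘(ℝ, ℝ) ∞ (LinearMap.piApply (hfr.coeff i) v) x₀ := by
    intro i
    have hsm : ContMDiffAt I 𝓘(ℝ, ℝ) ∞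
        (fun x => ∑ k, (A x)⁻¹ i k * θ x (e.localFrame b k x)) x₀ := by
      refine ContMDiffAt.sum fun k _ => ContMDiffAt.mul ?_ ?_
      · refine contMDiffAt_inv_apply (fun k j => ?_) (hdet x₀ hxV) i k
        exact (hsB V _ _ hVo inter_subset_left (hW j) (hW k)).contMDiffAt (hVo.mem_nhds hxV)
      · exact (hsθ V _ hVo inter_subset_left (hW k)).contMDiffAt (hVo.mem_nhds hxV)
    refine hsm.congr_of_eventuallyEq ?_
    filter_upwards [hVo.mem_nhds hxV] with x hx
    have hsys : (A x).mulVec (fun j => hfr.coeff j x (v x)) =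
        fun k => θ x (e.localFrame b k x) := by
      funext k
      rw [← hv x hx.1]
      conv_rhs => rw [hfr.coeff_sum_eq v hx.2]
      rw [map_sum, LinearMap.sum_apply]
      simp only [Matrix.mulVec, dotProduct, A, Matrix.of_apply]
      refine Finset.sum_congr rfl fun j _ => ?_
      simp [mul_comm]
    have h2 : (fun j => hfr.coeff j x (v x)) = (A x)⁻¹.mulVec (fun k => θ x (e.localFrame b k x)) := by
      rw [← hsys, Matrix.mulVec_mulVec, Matrix.nonsing_inv_mul _ (Ne.isUnit (hdet x hx)),
        Matrix.one_mulVec]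
    exact congrFun h2 i
  exact (hfr.contMDiffAt_of_coeff hcoef (e.open_baseSet.mem_nhds hxe)).contMDiffWithinAt

end Smoothness

/-! ### Canonical coordinates, the symplectic form and Hamiltonian fields on T*M. -/

section Cotangent

variable {E : Type*} [NormedAddCommGroup E] [NormedSpace ℝ E]
  {H : Type*} [TopologicalSpace H] {I : ModelWithCorners ℝ E H}
  {M : Type*} [TopologicalSpace M] [ChartedSpace H M]

/-- The exterior derivative of a `1`-form as a bilinear map. -/
def extDerivBilin (I : ModelWithCorners ℝ E H) (α : ∀ x : M, TangentSpace I x →L[ℝ] ℝ) (x : M) :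
    TangentSpace I x →ₗ[ℝ] TangentSpace I x →ₗ[ℝ] ℝ :=
  LinearMap.mk₂ ℝ (extDerivOne I α x)
    (fun u v w => by
      unfold extDerivOne
      rw [map_add]
      exact AlternatingMap.map_vecCons_add (extDeriv (formInChart I α x) _).toAlternatingMap _ _ _)
    (fun c v w => by
      unfold extDerivOne
      rw [map_smul]
      exact AlternatingMap.map_vecCons_smul (extDeriv (formInChart I α x) _).toAlternatingMap _ _ _)
    (fun u v w => by
      unfold extDerivOne
      rw [map_add]
      exact (((extDeriv (formInChart I α x) (extChartAt I x x)).toAlternatingMap.curryLeft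
        (mfderiv I 𝓘(ℝ, E) (extChartAt I x) x u)).map_vecCons_add _ _ _))
    (fun c u v => by
      unfold extDerivOne
      rw [map_smul]
      exact (((extDeriv (formInChart I α x) (extChartAt I x x)).toAlternatingMap.curryLeft
        (mfderiv I 𝓘(ℝ, E) (extChartAt I x) x u)).map_vecCons_smul _ _ _))

theorem extDerivBilin_apply (α : ∀ x : M, TangentSpace I x →L[ℝ] ℝ) (x : M)
    (v w : TangentSpace I x) : extDerivBilin I α x v w = extDerivOne I α x v w := rfl

theorem extDerivOne_self (α : ∀ x : M, TangentSpace I x →L[ℝ] ℝ) (x : M)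
    (v : TangentSpace I x) : extDerivOne I α x v v = 0 :=
  (extDeriv (formInChart I α x) (extChartAt I x x)).map_eq_zero_of_eq _
    (i := 0) (j := 1) rfl (by simp)

theorem extDerivOne_swap (α : ∀ x : M, TangentSpace I x →L[ℝ] ℝ) (x : M)
    (v w : TangentSpace I x) : extDerivOne I α x v w = -extDerivOne I α x w v := by
  have h := extDerivOne_self α x (v + w)
  rw [← extDerivBilin_apply] at h
  simp only [map_add, LinearMap.add_apply, extDerivBilin_apply, extDerivOne_self] at h
  linarith

theorem fderiv_dual_apply {c : E → E} {Q : E × (E →L[ℝ] ℝ)} (hc : DifferentiableAt ℝ c Q.1)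
    (V : E × (E →L[ℝ] ℝ)) :
    fderiv ℝ (fun Q : E × (E →L[ℝ] ℝ) => Q.2 (c Q.1)) Q V =
      V.2 (c Q.1) + Q.2 (fderiv ℝ c Q.1 V.1) := by
  have h2 := hc.hasFDerivAt.comp Q (hasFDerivAt_fst (𝕜 := ℝ) (E := E) (F := E →L[ℝ] ℝ))
  have h3 := (hasFDerivAt_snd (𝕜 := ℝ) (E := E) (F := E →L[ℝ] ℝ) (p := Q)).clm_apply h2
  simp only [Function.comp_apply] at h3
  rw [h3.fderiv]
  simp [add_comm]

variable [IsManifold I ∞ M]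

/-- The momentum `p ↦ p(X)` of a vector field. -/
def momentum (X : ∀ x : M, TangentSpace I x) (ζ : CotangentBundle I M) : ℝ := ζ.2 (X ζ.1)

theorem symmL_eq_mfderiv [I.Boundaryless] {x y : M} (hy : y ∈ (chartAt H x).source) {q : E}
    (hq : extChartAt I x y = q) (u : E) :
    modelEquiv I y ((trivializationAt E (TangentSpace I) x).symmL ℝ y u) =
      modelEquiv I ((extChartAt I x).symm q) (mfderiv 𝓘(ℝ, E) I (extChartAt I x).symm q u) := by
  subst hq
  rw [TangentBundle.symmL_trivializationAt (I := I) hy, I.range_eq_univ, mfderivWithin_univ]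
  rfl

theorem symmL_chartField [CompleteSpace E] {x y : M} (hy : y ∈ (chartAt H x).source)
    (X : ∀ x : M, TangentSpace I x) :
    (trivializationAt E (TangentSpace I) x).symmL ℝ y (chartField I X x (extChartAt I x y)) =
      X y := by
  have hy' : y ∈ (extChartAt I x).source := by rwa [extChartAt_source]
  obtain ⟨e, he⟩ := isInvertible_mfderivWithin_extChartAt_symm (I := I)
    ((extChartAt I x).map_source hy')
  rw [TangentBundle.symmL_trivializationAt (I := I) hy]
  unfold chartField
  rw [mpullbackWithin_apply, ← he, ContinuousLinearMap.inverse_equiv]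
  have h2 := congrArg (fun z => (X z : E)) ((extChartAt I x).left_inv hy')
  exact Eq.trans (e.apply_symm_apply (X ((extChartAt I x).symm (extChartAt I x y)))) h2

/-- The bundle charts of T*M are the canonical coordinates (q, p) over charts of M; all coordinate
formulas below rest on this. -/
theorem extChartAt_cotangent (ζ ξ : CotangentBundle I M) :
    extChartAt (cotangentModel I) ζ ξ = (extChartAt I ζ.1 ξ.1,
      (ξ.2 : TangentSpace I ξ.1 →L[ℝ] ℝ).comp
        ((trivializationAt E (TangentSpace I) ζ.1).symmL ℝ ξ.1)) := by
  have h1 : ContinuousLinearMap.inCoordinates E (TangentSpace I) ℝ (fun _ : M => ℝ) ζ.1 ξ.1 ζ.1 ξ.1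
      ξ.2 = (ξ.2 : TangentSpace I ξ.1 →L[ℝ] ℝ).comp
        ((trivializationAt E (TangentSpace I) ζ.1).symmL ℝ ξ.1) := by
    ext v
    simp [ContinuousLinearMap.inCoordinates]
  rw [← h1, FiberBundle.extChartAt]
  rfl

theorem extChartAt_cotangent_self (ζ : CotangentBundle I M) (v : TangentSpace I ζ.1) :
    (extChartAt (cotangentModel I) ζ ζ).2 (modelEquiv I ζ.1 v) = ζ.2 v := by
  rw [extChartAt_cotangent]
  change ζ.2 ((trivializationAt E (TangentSpace I) ζ.1).symmL ℝ ζ.1 (modelEquiv I ζ.1 v)) = ζ.2 v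
  rw [TangentBundle.symmL_trivializationAt (I := I) (mem_chart_source H ζ.1),
    mfderivWithin_range_extChartAt_symm]
  rfl

theorem mem_extChartAt_cotangent_source {ζ ξ : CotangentBundle I M} :
    ξ ∈ (extChartAt (cotangentModel I) ζ).source ↔ ξ.1 ∈ (chartAt H ζ.1).source := by
  rw [FiberBundle.extChartAt]
  simp only [PartialEquiv.trans_source, mem_inter_iff]
  rw [Bundle.Trivialization.mem_source]
  simp
  exact fun h => h

theorem momentum_eq_chart [CompleteSpace E] (X : ∀ x : M, TangentSpace I x)
    (ζ : CotangentBundle I M) :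
    momentum X =ᶠ[𝓝 ζ] fun ξ => (fun Q : E × (E →L[ℝ] ℝ) => Q.2 (chartField I X ζ.1 Q.1))
      (extChartAt (cotangentModel I) ζ ξ) := by
  filter_upwards [extChartAt_source_mem_nhds (I := cotangentModel I) ζ] with ξ hξ
  rw [mem_extChartAt_cotangent_source] at hξ
  rw [extChartAt_cotangent]
  change _ = ξ.2 ((trivializationAt E (TangentSpace I) ζ.1).symmL ℝ ξ.1
    (chartField I X ζ.1 (extChartAt I ζ.1 ξ.1)))
  rw [symmL_chartField hξ]
  rfl

/-- In canonical coordinates the form is p dq. Indeed the projection composed with the inverse chart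
of T*M is the inverse chart of M composed with `Prod.fst`, so a vector w is sent to the image of
w.1, on which the covector takes the value Q.2 w.1. -/
theorem chartForm_liouvilleForm [I.Boundaryless] {ζ : CotangentBundle I M}
    {Q : E × (E →L[ℝ] ℝ)} (hQ : Q ∈ (extChartAt (cotangentModel I) ζ).target) :
    chartForm (cotangentModel I) (liouvilleForm I) ζ Q =
      Q.2.comp (ContinuousLinearMap.fst ℝ E (E →L[ℝ] ℝ)) := by
  set Φ := extChartAt (cotangentModel I) ζ with hΦ
  set ξ := Φ.symm Q with hξ
  have hξs : ξ.1 ∈ (chartAt H ζ.1).source := by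
    have := Φ.map_target hQ
    rwa [hΦ, mem_extChartAt_cotangent_source] at this
  have hQ' : Φ ξ = Q := Φ.right_inv hQ
  have hq : extChartAt I ζ.1 ξ.1 = Q.1 := by rw [← hQ', hΦ, extChartAt_cotangent]
  have hqt : Q.1 ∈ (extChartAt I ζ.1).target := by
    rw [← hq]
    exact (extChartAt I ζ.1).map_source (by rwa [extChartAt_source])
  have hev : (fun z : CotangentBundle I M => z.1) ∘ Φ.symm =ᶠ[𝓝 Q]
      (extChartAt I ζ.1).symm ∘ Prod.fst := by
    have ht : Φ.target ∈ 𝓝 Q := (isOpen_extChartAt_target ζ).mem_nhds hQ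
    filter_upwards [ht] with R hR
    have h1 : (Φ.symm R).1 ∈ (extChartAt I ζ.1).source := by
      have := Φ.map_target hR
      rw [hΦ, mem_extChartAt_cotangent_source] at this
      rwa [extChartAt_source]
    have h2 : Φ (Φ.symm R) = R := Φ.right_inv hR
    have h3 : extChartAt I ζ.1 (Φ.symm R).1 = R.1 := by
      conv_rhs => rw [← h2]
      rw [hΦ, extChartAt_cotangent]
    simp only [Function.comp_apply]
    rw [← h3, (extChartAt I ζ.1).left_inv h1]
  have hdΦ : MDifferentiableAt 𝓘(ℝ, E × (E →L[ℝ] ℝ)) (cotangentModel I) Φ.symm Q := by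
    have := mdifferentiableWithinAt_extChartAt_symm (I := cotangentModel I) hQ
    rwa [ModelWithCorners.range_eq_univ, mdifferentiableWithinAt_univ] at this
  have hdφ : MDifferentiableAt 𝓘(ℝ, E) I (extChartAt I ζ.1).symm Q.1 := by
    have := mdifferentiableWithinAt_extChartAt_symm (I := I) hqt
    rwa [I.range_eq_univ, mdifferentiableWithinAt_univ] at this
  have hdπ : MDifferentiableAt (cotangentModel I) I (fun z : CotangentBundle I M => z.1) ξ :=
    (Bundle.contMDiffAt_proj (n := 1) (fun x : M => TangentSpace I x →L[ℝ] ℝ)).mdifferentiableAt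
      (by simp)
  have e1 := mfderiv_comp Q hdπ hdΦ
  have hdf : HasMFDerivAt 𝓘(ℝ, E × (E →L[ℝ] ℝ)) 𝓘(ℝ, E) (Prod.fst : E × (E →L[ℝ] ℝ) → E) Q
      (ContinuousLinearMap.fst ℝ E (E →L[ℝ] ℝ)) := hasFDerivAt_fst.hasMFDerivAt
  have e2 := (HasMFDerivAt.comp Q hdφ.hasMFDerivAt hdf).mfderiv
  refine ContinuousLinearMap.ext fun w => ?_
  have e3 : (show E from mfderiv 𝓘(ℝ, E × (E →L[ℝ] ℝ)) I
      ((fun z : CotangentBundle I M => z.1) ∘ Φ.symm) Q w) =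
      (trivializationAt E (TangentSpace I) ζ.1).symmL ℝ ξ.1 w.1 := by
    rw [hev.mfderiv_eq, e2]
    exact (symmL_eq_mfderiv hξs hq w.1).symm
  have e4 : chartForm (cotangentModel I) (liouvilleForm I) ζ Q w =
      (show E →L[ℝ] ℝ from ξ.2) (show E from mfderiv 𝓘(ℝ, E × (E →L[ℝ] ℝ)) I
      ((fun z : CotangentBundle I M => z.1) ∘ Φ.symm) Q w) := by
    rw [e1]
    rfl
  rw [e4, e3]
  conv_rhs => rw [← hQ', hΦ, extChartAt_cotangent]
  rfl

variable [I.Boundaryless]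

theorem chartForm_liouvilleForm_eventuallyEq (ζ : CotangentBundle I M) :
    chartForm (cotangentModel I) (liouvilleForm I) ζ =ᶠ[𝓝 (extChartAt (cotangentModel I) ζ ζ)]
      fun Q => Q.2.comp (ContinuousLinearMap.fst ℝ E (E →L[ℝ] ℝ)) := by
  filter_upwards [extChartAt_target_mem_nhds (I := cotangentModel I) ζ] with Q hQ
  exact chartForm_liouvilleForm hQ

theorem smoothFormOn_liouvilleForm :
    SmoothFormOn (cotangentModel I) (liouvilleForm (M := M) I) univ := by
  rw [smoothFormOn_iff isOpen_univ]
  intro ζ _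
  refine ContDiffAt.congr_of_eventuallyEq ?_ (chartForm_liouvilleForm_eventuallyEq ζ)
  exact (contDiff_snd.clm_comp contDiff_const).contDiffAt

/-- The standard symplectic form in coordinates. -/
theorem symplecticForm_eq (ζ : CotangentBundle I M)
    (v w : TangentSpace (cotangentModel I) ζ) :
    symplecticForm I ζ v w =
      (modelEquiv (cotangentModel I) ζ w).2 (modelEquiv (cotangentModel I) ζ v).1 -
        (modelEquiv (cotangentModel I) ζ v).2 (modelEquiv (cotangentModel I) ζ w).1 := by
  have hd := smoothFormOn_liouvilleForm (I := I) (M := M).differentiableAt isOpen_univ (mem_univ ζ)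
  unfold symplecticForm
  rw [extDerivOne_eq_fderiv_chartForm hd, (chartForm_liouvilleForm_eventuallyEq ζ).fderiv_eq]
  have hf : ∀ Q V : E × (E →L[ℝ] ℝ), fderiv ℝ (fun Q : E × (E →L[ℝ] ℝ) =>
      Q.2.comp (ContinuousLinearMap.fst ℝ E (E →L[ℝ] ℝ))) Q V =
      V.2.comp (ContinuousLinearMap.fst ℝ E (E →L[ℝ] ℝ)) := by
    intro Q V
    rw [fderiv_clm_comp differentiableAt_snd (differentiableAt_const _)]
    simp [fderiv_snd]
  rw [hf, hf]
  simp

theorem symplecticForm_swap (ζ : CotangentBundle I M) (v w : TangentSpace (cotangentModel I) ζ) :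
    symplecticForm I ζ v w = -symplecticForm I ζ w v := by
  rw [symplecticForm_eq, symplecticForm_eq]
  ring

variable (I) in
/-- The symplectic form as a bilinear map. -/
def symplecticBilin (ζ : CotangentBundle I M) :
    TangentSpace (cotangentModel I) ζ →ₗ[ℝ] TangentSpace (cotangentModel I) ζ →ₗ[ℝ] ℝ :=
  -extDerivBilin (cotangentModel I) (liouvilleForm I) ζ

omit [I.Boundaryless] in
theorem symplecticBilin_apply (ζ : CotangentBundle I M)
    (v w : TangentSpace (cotangentModel I) ζ) :
    symplecticBilin I ζ v w = symplecticForm I ζ v w := rfl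

variable [FiniteDimensional ℝ E]

-- Vertical test vectors (0, r) force the base component of v to vanish, because covectors separate
-- points; horizontal ones (u, 0) force the fibre component to vanish.
omit [FiniteDimensional ℝ E] in
theorem symplecticForm_nondegenerate (ζ : CotangentBundle I M)
    (v : TangentSpace (cotangentModel I) ζ) (h : ∀ w, symplecticForm I ζ v w = 0) : v = 0 := by
  have h' : ∀ W : E × (E →L[ℝ] ℝ), W.2 (modelEquiv (cotangentModel I) ζ v).1 -
      (modelEquiv (cotangentModel I) ζ v).2 W.1 = 0 := by
    intro W
    have := h ((modelEquiv (cotangentModel I) ζ).symm W)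
    rwa [symplecticForm_eq, ContinuousLinearEquiv.apply_symm_apply] at this
  have h1 : (modelEquiv (cotangentModel I) ζ v).1 = 0 := by
    by_contra hne
    obtain ⟨r, hr⟩ := SeparatingDual.exists_ne_zero (R := ℝ) hne
    have := h' (0, r)
    simp at this
    exact hr this
  have h2 : (modelEquiv (cotangentModel I) ζ v).2 = 0 := by
    ext u
    have := h' (u, 0)
    simpa using this
  apply (modelEquiv (cotangentModel I) ζ).injective
  rw [map_zero]
  exact Prod.ext h1 h2

/-- The choice in `sgrad` is meaningful: in finite dimension nondegeneracy makes v ↦ Ω(v, ·)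
bijective onto the dual. No differentiability of F enters, since `mfderiv` is always some linear
form. -/
theorem sgrad_spec (F : CotangentBundle I M → ℝ) (ζ : CotangentBundle I M)
    (w : TangentSpace (cotangentModel I) ζ) :
    symplecticForm I ζ (sgrad I F ζ) w = differential (cotangentModel I) F ζ w := by
  have hfd : FiniteDimensional ℝ (TangentSpace (cotangentModel I) ζ) :=
    inferInstanceAs (FiniteDimensional ℝ (E × (E →L[ℝ] ℝ)))
  have hinj : Function.Injective (symplecticBilin I ζ) := by
    rw [injective_iff_map_eq_zero]
    intro v hv
    refine symplecticForm_nondegenerate ζ v fun w => ?_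
    rw [← symplecticBilin_apply, hv]
    rfl
  have hsurj := (LinearMap.injective_iff_surjective_of_finrank_eq_finrank
    (f := symplecticBilin I ζ) (by
      rw [Module.finrank_linearMap, Module.finrank_self, mul_one])).1 hinj
  obtain ⟨v, hv⟩ := hsurj (differential (cotangentModel I) F ζ).toLinearMap
  have hex : ∃ v : TangentSpace (cotangentModel I) ζ,
      ∀ w, symplecticForm I ζ v w = mfderiv (cotangentModel I) 𝓘(ℝ, ℝ) F ζ w :=
    ⟨v, fun w => by
      rw [← symplecticBilin_apply, hv]
      rfl⟩
  exact Classical.epsilon_spec hex w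

/-- Hamiltonian fields of smooth functions are smooth. -/
theorem smoothFieldOn_sgrad {F : CotangentBundle I M → ℝ} {U : Set (CotangentBundle I M)}
    (hU : IsOpen U) (hF : ContMDiffOn (cotangentModel I) 𝓘(ℝ, ℝ) ∞ F U) :
    SmoothFieldOn (cotangentModel I) (sgrad I F) U := by
  refine smoothFieldOn_of_bilin hU (B := symplecticBilin I)
    (θ := fun ζ => (differential (cotangentModel I) F ζ).toLinearMap) ?_ ?_ ?_ ?_
  · exact fun ζ _ v hv => symplecticForm_nondegenerate ζ v hv
  · intro V X Y hV _ hX hY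
    have hl : SmoothFormOn (cotangentModel I) (liouvilleForm (M := M) I) V :=
      ContMDiffOn.mono smoothFormOn_liouvilleForm (subset_univ V)
    exact (hl.extDerivOne hV hX hY).neg
  · intro V Y hV hVU hY
    exact hY.differential hV (hF.mono hVU)
  · exact fun ζ _ w => sgrad_spec F ζ w

/-- The Hamiltonian lift of a vector field: the Hamiltonian field of its momentum. -/
def cotangentLift (X : ∀ x : M, TangentSpace I x) (ζ : CotangentBundle I M) :
    TangentSpace (cotangentModel I) ζ :=
  (modelEquiv (cotangentModel I) ζ).symm (chartField I X ζ.1 (extChartAt I ζ.1 ζ.1),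
    -((extChartAt (cotangentModel I) ζ ζ).2.comp
      (fderiv ℝ (chartField I X ζ.1) (extChartAt I ζ.1 ζ.1))))

theorem differentiableAt_momentum_chart {X : ∀ x : M, TangentSpace I x} {ζ : CotangentBundle I M}
    (hX : MDifferentiableAt I I.tangent (fun y => (⟨y, X y⟩ : TangentBundle I M)) ζ.1) :
    DifferentiableAt ℝ (fun Q : E × (E →L[ℝ] ℝ) => Q.2 (chartField I X ζ.1 Q.1))
      (extChartAt (cotangentModel I) ζ ζ) := by
  have h := differentiableAt_chartField hX
  have h1 : (extChartAt (cotangentModel I) ζ ζ).1 = extChartAt I ζ.1 ζ.1 := by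
    rw [extChartAt_cotangent]
  rw [← h1] at h
  exact differentiableAt_snd.clm_apply (h.comp _ differentiableAt_fst)

theorem differential_momentum {X : ∀ x : M, TangentSpace I x} {ζ : CotangentBundle I M}
    (hX : MDifferentiableAt I I.tangent (fun y => (⟨y, X y⟩ : TangentBundle I M)) ζ.1)
    (w : TangentSpace (cotangentModel I) ζ) :
    differential (cotangentModel I) (momentum X) ζ w =
      (modelEquiv (cotangentModel I) ζ w).2 (chartField I X ζ.1 (extChartAt I ζ.1 ζ.1)) +
        (extChartAt (cotangentModel I) ζ ζ).2 (fderiv ℝ (chartField I X ζ.1)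
          (extChartAt I ζ.1 ζ.1) (modelEquiv (cotangentModel I) ζ w).1) := by
  have h := differentiableAt_chartField hX
  have h1 : (extChartAt (cotangentModel I) ζ ζ).1 = extChartAt I ζ.1 ζ.1 := by
    rw [extChartAt_cotangent]
  rw [differential_of_eventuallyEq_chart (differentiableAt_momentum_chart hX)
    (momentum_eq_chart X ζ)]
  rw [← h1] at h
  rw [fderiv_dual_apply h, h1]

/-- Hamilton's equations for the function p(X): velocity X in the base, -p ∘ DX in the fibre. This
justifies the coordinate definition of `cotangentLift`. -/
theorem symplecticForm_cotangentLift {X : ∀ x : M, TangentSpace I x} {ζ : CotangentBundle I M}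
    (hX : MDifferentiableAt I I.tangent (fun y => (⟨y, X y⟩ : TangentBundle I M)) ζ.1)
    (w : TangentSpace (cotangentModel I) ζ) :
    symplecticForm I ζ (cotangentLift X ζ) w =
      differential (cotangentModel I) (momentum X) ζ w := by
  rw [differential_momentum hX, symplecticForm_eq, cotangentLift,
    ContinuousLinearEquiv.apply_symm_apply]
  simp

/-- The Poisson bracket of momenta is the momentum of the Lie bracket. -/
theorem differential_momentum_cotangentLift {X Y : ∀ x : M, TangentSpace I x}
    {ζ : CotangentBundle I M}
    (hY : MDifferentiableAt I I.tangent (fun y => (⟨y, Y y⟩ : TangentBundle I M)) ζ.1) :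
    differential (cotangentModel I) (momentum Y) ζ (cotangentLift X ζ) =
      ζ.2 (mlieBracket I X Y ζ.1) := by
  rw [differential_momentum hY, ← extChartAt_cotangent_self, modelEquiv_mlieBracket,
    cotangentLift, ContinuousLinearEquiv.apply_symm_apply, lieBracket, map_sub]
  simp only [neg_apply, ContinuousLinearMap.comp_apply]
  ring

-- The base component of the lift is X, so functions pulled back from M are differentiated along X.
omit [FiniteDimensional ℝ E] in
theorem differential_comp_proj {f : M → ℝ} {X : ∀ x : M, TangentSpace I x}
    {ζ : CotangentBundle I M} (hf : MDifferentiableAt I 𝓘(ℝ, ℝ) f ζ.1) :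
    differential (cotangentModel I) (fun ξ => f ξ.1) ζ (cotangentLift X ζ) =
      differential I f ζ.1 (X ζ.1) := by
  have h1 : (extChartAt (cotangentModel I) ζ ζ).1 = extChartAt I ζ.1 ζ.1 := by
    rw [extChartAt_cotangent]
  have hsymm : MDifferentiableAt 𝓘(ℝ, E) I (extChartAt I ζ.1).symm (extChartAt I ζ.1 ζ.1) := by
    have := mdifferentiableWithinAt_extChartAt_symm (I := I) (mem_extChartAt_target ζ.1)
    rwa [I.range_eq_univ, mdifferentiableWithinAt_univ] at this
  have hg : DifferentiableAt ℝ (f ∘ (extChartAt I ζ.1).symm) (extChartAt I ζ.1 ζ.1) := by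
    rw [← mdifferentiableAt_iff_differentiableAt]
    refine MDifferentiableAt.comp _ ?_ hsymm
    rwa [extChartAt_to_inv]
  have e1 : f =ᶠ[𝓝 ζ.1] fun y => (f ∘ (extChartAt I ζ.1).symm) (extChartAt I ζ.1 y) := by
    filter_upwards [extChartAt_source_mem_nhds (I := I) ζ.1] with y hy
    simp only [Function.comp_apply]
    rw [(extChartAt I ζ.1).left_inv hy]
  have e2 : (fun ξ : CotangentBundle I M => f ξ.1) =ᶠ[𝓝 ζ] fun ξ =>
      (fun Q : E × (E →L[ℝ] ℝ) => (f ∘ (extChartAt I ζ.1).symm) Q.1)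
        (extChartAt (cotangentModel I) ζ ξ) := by
    filter_upwards [extChartAt_source_mem_nhds (I := cotangentModel I) ζ] with ξ hξ
    rw [mem_extChartAt_cotangent_source] at hξ
    rw [extChartAt_cotangent]
    simp only [Function.comp_apply]
    rw [(extChartAt I ζ.1).left_inv (by rwa [extChartAt_source])]
  have hg' := hg
  rw [← h1] at hg'
  have h2 := hg'.hasFDerivAt.comp (extChartAt (cotangentModel I) ζ ζ)
    (hasFDerivAt_fst (𝕜 := ℝ) (E := E) (F := E →L[ℝ] ℝ))
  rw [differential_of_eventuallyEq_chart hg e1,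
    differential_of_eventuallyEq_chart h2.differentiableAt e2]
  have h3 := h2.fderiv
  rw [h1] at h3
  refine (congrArg (fun L : E × (E →L[ℝ] ℝ) →L[ℝ] ℝ =>
    L (modelEquiv (cotangentModel I) ζ (cotangentLift X ζ))) h3).trans ?_
  rw [cotangentLift, ContinuousLinearEquiv.apply_symm_apply]
  rw [← chartField_self]
  rfl

omit [I.Boundaryless] [FiniteDimensional ℝ E] in
/-- The momentum of a smooth field is smooth. -/
theorem contMDiffOn_momentum {X : ∀ x : M, TangentSpace I x} {U : Set M}
    (hX : SmoothFieldOn I X U) :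
    ContMDiffOn (cotangentModel I) 𝓘(ℝ, ℝ) ∞ (momentum X)
      ((fun ζ : CotangentBundle I M => ζ.1) ⁻¹' U) := by
  have h1 : ContMDiffOn (cotangentModel I) I ∞ (fun ζ : CotangentBundle I M => ζ.1)
      ((fun ζ : CotangentBundle I M => ζ.1) ⁻¹' U) :=
    (Bundle.contMDiff_proj (fun x : M => TangentSpace I x →L[ℝ] ℝ)).contMDiffOn
  have h2 := ContMDiffOn.comp hX h1 (fun ζ hζ => hζ)
  have h3 : ContMDiffOn (cotangentModel I) (cotangentModel I) ∞
      (fun ζ : CotangentBundle I M => (⟨ζ.1, ζ.2⟩ : CotangentBundle I M))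
      ((fun ζ : CotangentBundle I M => ζ.1) ⁻¹' U) := contMDiffOn_id
  have h4 := ContMDiffOn.clm_bundle_apply (E₂ := fun _ : M => ℝ) (F₂ := ℝ)
    (b := fun ζ : CotangentBundle I M => ζ.1) h3 h2
  intro ζ hζ
  exact (Bundle.contMDiffWithinAt_totalSpace.1 (h4 ζ hζ)).2

end Cotangent

/-! ### First integrals as functions annihilated by the Hamiltonian field. -/

section FirstIntegral

variable {E : Type*} [NormedAddCommGroup E] [NormedSpace ℝ E] [FiniteDimensional ℝ E]
  {H : Type*} [TopologicalSpace H] {I : ModelWithCorners ℝ E H} [I.Boundaryless]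
  {M : Type*} [TopologicalSpace M] [ChartedSpace H M] [IsManifold I ∞ M]

omit [FiniteDimensional ℝ E] [I.Boundaryless] in
theorem hasDerivAt_comp_integralCurve {J : CotangentBundle I M → ℝ}
    {γ : ℝ → CotangentBundle I M} {t : ℝ} {v : TangentSpace (cotangentModel I) (γ t)}
    (hJ : MDifferentiableAt (cotangentModel I) 𝓘(ℝ, ℝ) J (γ t))
    (hγ : HasMFDerivAt 𝓘(ℝ, ℝ) (cotangentModel I) γ t ((1 : ℝ →L[ℝ] ℝ).smulRight v)) :
    HasDerivAt (J ∘ γ) (differential (cotangentModel I) J (γ t) v) t := by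
  have h1 : HasFDerivAt (J ∘ γ) ((differential (cotangentModel I) J (γ t)).comp
      ((1 : ℝ →L[ℝ] ℝ).smulRight v)) t :=
    (HasMFDerivAt.comp t hJ.hasMFDerivAt hγ).hasFDerivAt
  have h2 : HasDerivAt (J ∘ γ) (((differential (cotangentModel I) J (γ t)).comp
      ((1 : ℝ →L[ℝ] ℝ).smulRight v)) 1) t := h1.hasDerivAt
  have h3 : ((differential (cotangentModel I) J (γ t)).comp
      ((1 : ℝ →L[ℝ] ℝ).smulRight v)) 1 = differential (cotangentModel I) J (γ t) v := by
    rw [ContinuousLinearMap.comp_apply, ContinuousLinearMap.smulRight_apply,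
      one_apply_eq_self, one_smul]
  rwa [h3] at h2

/-- A function is a first integral iff its differential vanishes on the Hamiltonian field. -/
theorem isFirstIntegral_iff {F J : CotangentBundle I M → ℝ}
    (hF : ContMDiff (cotangentModel I) 𝓘(ℝ, ℝ) ∞ F)
    (hJ : MDifferentiable (cotangentModel I) 𝓘(ℝ, ℝ) J) :
    IsFirstIntegral I F J ↔ ∀ ζ, differential (cotangentModel I) J ζ (sgrad I F ζ) = 0 := by
  constructor
  · intro h ζ
    -- Constancy along trajectories gives information at ζ only if a trajectory passes through ζ; it
    -- exists because `sgrad I F` is C¹ and there is no boundary.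
    have hs : ContMDiffAt (cotangentModel I) (cotangentModel I).tangent 1
        (fun ξ => (⟨ξ, sgrad I F ξ⟩ : TangentBundle (cotangentModel I) (CotangentBundle I M))) ζ :=
      ((smoothFieldOn_sgrad isOpen_univ hF.contMDiffOn).contMDiffAt univ_mem).of_le (by simp)
    obtain ⟨γ, hγ0, hγ⟩ := exists_isMIntegralCurveAt_of_contMDiffAt_boundaryless 0 hs
    obtain ⟨ε, hε, hball⟩ := isMIntegralCurveAt_iff'.1 hγ
    rw [Real.ball_eq_Ioo, zero_sub, zero_add] at hball
    have hd := hasDerivAt_comp_integralCurve (hJ (γ 0)) hγ.hasMFDerivAt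
    have hc : J ∘ γ =ᶠ[𝓝 0] fun _ => J (γ 0) := by
      filter_upwards [Ioo_mem_nhds (neg_lt_zero.2 hε) hε] with t ht
      exact h γ _ _ hball t ht 0 ⟨neg_lt_zero.2 hε, hε⟩
    have := hd.unique ((hasDerivAt_const 0 (J (γ 0))).congr_of_eventuallyEq hc)
    rwa [hγ0] at this
  · intro h γ a b hγ s hs t ht
    have hd : ∀ t ∈ Ioo a b, HasDerivAt (J ∘ γ) 0 t := by
      intro t ht
      have := hasDerivAt_comp_integralCurve (hJ (γ t))
        ((hγ t ht).hasMFDerivAt (Ioo_mem_nhds ht.1 ht.2))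
      rwa [h] at this
    exact isOpen_Ioo.is_const_of_deriv_eq_zero isPreconnected_Ioo
      (fun t ht => (hd t ht).differentiableAt.differentiableWithinAt)
      (fun t ht => (hd t ht).deriv) hs ht

end FirstIntegral

/-! ### Exterior powers of a bilinear form and Gram determinants. -/

section LinearAlgebra

variable {V : Type*} [AddCommGroup V] [Module ℝ V]

/-- The multilinear map `v ↦ ∏ i, β (v (2 * i)) (v (2 * i + 1))`. -/
def pairingProd (n : ℕ) (β : V →ₗ[ℝ] V →ₗ[ℝ] ℝ) :
    MultilinearMap ℝ (fun _ : Fin (2 * n) => V) ℝ :=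
  -- Slot j occurs only in the factor with index j / 2, so multilinearity of the product reduces to
  -- linearity of that one factor.
  have key : ∀ (h : DecidableEq (Fin (2 * n))) (v : Fin (2 * n) → V) (j : Fin (2 * n)) (x : V),
      ∏ i : Fin n, β (Function.update v j x ⟨2 * i, by omega⟩)
          (Function.update v j x ⟨2 * i + 1, by omega⟩) =
        β (Function.update v j x ⟨2 * (j / 2), by omega⟩)
          (Function.update v j x ⟨2 * (j / 2) + 1, by omega⟩) *
        ∏ i ∈ Finset.univ.erase (⟨j / 2, by omega⟩ : Fin n),
          β (v ⟨2 * i, by omega⟩) (v ⟨2 * i + 1, by omega⟩) := by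
    intro _ v j x
    rw [← Finset.mul_prod_erase Finset.univ _ (Finset.mem_univ (⟨j / 2, by omega⟩ : Fin n))]
    congr 1
    refine Finset.prod_congr rfl fun i hi => ?_
    have hne : (i : ℕ) ≠ j / 2 := fun h => (Finset.mem_erase.1 hi).1 (Fin.ext h)
    rw [Function.update_of_ne, Function.update_of_ne]
    · exact fun h => hne (by have := congrArg Fin.val h; simp only at this; omega)
    · exact fun h => hne (by have := congrArg Fin.val h; simp only at this; omega)
  have slot : ∀ (h : DecidableEq (Fin (2 * n))) (v : Fin (2 * n) → V) (j : Fin (2 * n)),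
      ∃ L : V →ₗ[ℝ] ℝ, ∀ x, β (Function.update v j x ⟨2 * (j / 2), by omega⟩)
          (Function.update v j x ⟨2 * (j / 2) + 1, by omega⟩) = L x := by
    intro _ v j
    rcases Nat.even_or_odd' (j : ℕ) with ⟨k, hk | hk⟩
    · refine ⟨β.flip (v ⟨2 * (j / 2) + 1, by omega⟩), fun x => ?_⟩
      have e1 : (⟨2 * (j / 2), by omega⟩ : Fin (2 * n)) = j := Fin.ext (by simp only; omega)
      have e2 : (⟨2 * (j / 2) + 1, by omega⟩ : Fin (2 * n)) ≠ j := fun h => by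
        have := congrArg Fin.val h
        simp only at this
        omega
      rw [Function.update_of_ne e2, e1, Function.update_self]
      rfl
    · refine ⟨β (v ⟨2 * (j / 2), by omega⟩), fun x => ?_⟩
      have e1 : (⟨2 * (j / 2) + 1, by omega⟩ : Fin (2 * n)) = j := Fin.ext (by simp only; omega)
      have e2 : (⟨2 * (j / 2), by omega⟩ : Fin (2 * n)) ≠ j := fun h => by
        have := congrArg Fin.val h
        simp only at this
        omega
      rw [Function.update_of_ne e2, e1, Function.update_self]
  { toFun := fun v => ∏ i : Fin n, β (v ⟨2 * i, by omega⟩) (v ⟨2 * i + 1, by omega⟩)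
    map_update_add' := by
      intro _ v j x y
      obtain ⟨L, hL⟩ := slot inferInstance v j
      rw [key, key, key, hL, hL, hL, map_add, add_mul]
    map_update_smul' := by
      intro _ v j c x
      obtain ⟨L, hL⟩ := slot inferInstance v j
      rw [key, key, hL, hL, map_smul, smul_eq_mul, smul_eq_mul, mul_assoc] }

theorem pairingProd_apply (n : ℕ) (β : V →ₗ[ℝ] V →ₗ[ℝ] ℝ) (v : Fin (2 * n) → V) :
    pairingProd n β v = ∏ i : Fin n, β (v ⟨2 * i, by omega⟩) (v ⟨2 * i + 1, by omega⟩) := rfl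

/-- The power `β ∧ ⋯ ∧ β` as an alternating map. -/
def formPowAlt (n : ℕ) (β : V →ₗ[ℝ] V →ₗ[ℝ] ℝ) : V [⋀^Fin (2 * n)]→ₗ[ℝ] ℝ :=
  (1 / 2 ^ n : ℝ) • MultilinearMap.alternatization (pairingProd n β)

theorem formPowAlt_apply (n : ℕ) (β : V →ₗ[ℝ] V →ₗ[ℝ] ℝ) (v : Fin (2 * n) → V) :
    formPowAlt n β v = formPow n (fun u w => β u w) v := by
  unfold formPowAlt formPow
  rw [AlternatingMap.smul_apply, MultilinearMap.alternatization_apply, smul_eq_mul]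
  congr 1
  refine Finset.sum_congr rfl fun σ _ => ?_
  rw [MultilinearMap.domDomCongr_apply, pairingProd_apply, Units.smul_def, zsmul_eq_mul]

/-- The product `a ∧ β ∧ ⋯ ∧ β` as an alternating map. -/
def wedgeFormPowAlt (n : ℕ) (a : V →ₗ[ℝ] ℝ) (β : V →ₗ[ℝ] V →ₗ[ℝ] ℝ) :
    V [⋀^Fin (2 * n + 1)]→ₗ[ℝ] ℝ :=
  (1 / 2 ^ n : ℝ) • MultilinearMap.alternatization
    (LinearMap.uncurryLeft (M := fun _ : Fin (2 * n + 1) => V) (a.smulRight (pairingProd n β)))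

theorem wedgeFormPowAlt_apply (n : ℕ) (a : V →ₗ[ℝ] ℝ) (β : V →ₗ[ℝ] V →ₗ[ℝ] ℝ)
    (v : Fin (2 * n + 1) → V) :
    wedgeFormPowAlt n a β v = wedgeFormPow n (fun u => a u) (fun u w => β u w) v := by
  unfold wedgeFormPowAlt wedgeFormPow
  rw [AlternatingMap.smul_apply, MultilinearMap.alternatization_apply, smul_eq_mul]
  congr 1
  refine Finset.sum_congr rfl fun σ _ => ?_
  rw [MultilinearMap.domDomCongr_apply, LinearMap.uncurryLeft_apply, Units.smul_def, zsmul_eq_mul]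
  rfl

/-- On a basis adapted to `ker a`, the form `a ∧ βⁿ` is determined by `βⁿ`. -/
theorem wedgeFormPow_cons (n : ℕ) (a : V →ₗ[ℝ] ℝ) (β : V →ₗ[ℝ] V →ₗ[ℝ] ℝ) (u : V)
    (ξ : Fin (2 * n) → V) (hξ : ∀ i, a (ξ i) = 0) :
    wedgeFormPow n (fun u => a u) (fun u w => β u w) (Fin.cons u ξ) =
      a u * formPow n (fun u w => β u w) ξ := by
  unfold wedgeFormPow formPow
  rw [← mul_assoc, mul_comm (a u), mul_assoc]
  congr 1
  -- Permutations are sorted by the image of 0. If that image is not 0, then a is evaluated on some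
  -- ξ i and the term vanishes; the remaining ones are the permutations of the last 2n slots, with
  -- the same sign.
  rw [← Equiv.Perm.decomposeFin.symm.sum_comp, Fintype.sum_prod_type, Finset.sum_eq_single 0]
  · rw [Finset.mul_sum]
    refine Finset.sum_congr rfl fun e _ => ?_
    rw [Equiv.Perm.decomposeFin.symm_sign]
    have h0 : Equiv.Perm.decomposeFin.symm ((0 : Fin (2 * n + 1)), e) ⟨0, by omega⟩ = 0 :=
      Equiv.Perm.decomposeFin_symm_apply_zero 0 e
    have hs : ∀ (k : ℕ) (hk : k < 2 * n),
        (Fin.cons u ξ : Fin (2 * n + 1) → V)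
          (Equiv.Perm.decomposeFin.symm ((0 : Fin (2 * n + 1)), e) ⟨k + 1, by omega⟩) =
        ξ (e ⟨k, hk⟩) := by
      intro k hk
      have := Equiv.Perm.decomposeFin_symm_apply_succ e 0 ⟨k, hk⟩
      rw [Equiv.swap_self, Equiv.refl_apply] at this
      rw [← Fin.cons_succ (α := fun _ => V) u ξ (e ⟨k, hk⟩), ← this]
      rfl
    rw [h0, Fin.cons_zero]
    simp only [if_true, one_mul]
    have : ∀ i : Fin n, β ((Fin.cons u ξ : Fin (2 * n + 1) → V)
          (Equiv.Perm.decomposeFin.symm ((0 : Fin (2 * n + 1)), e) ⟨2 * i + 1, by omega⟩))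
        ((Fin.cons u ξ : Fin (2 * n + 1) → V)
          (Equiv.Perm.decomposeFin.symm ((0 : Fin (2 * n + 1)), e) ⟨2 * i + 2, by omega⟩)) =
        β (ξ (e ⟨2 * i, by omega⟩)) (ξ (e ⟨2 * i + 1, by omega⟩)) := by
      intro i
      rw [hs (2 * i) (by omega), hs (2 * i + 1) (by omega)]
    simp only [this]
    ring
  · intro p _ hp
    refine Finset.sum_eq_zero fun e _ => ?_
    have h0 : Equiv.Perm.decomposeFin.symm (p, e) ⟨0, by omega⟩ = p :=
      Equiv.Perm.decomposeFin_symm_apply_zero p e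
    obtain ⟨q, rfl⟩ := Fin.exists_succ_eq.2 hp
    rw [h0, Fin.cons_succ]
    simp [hξ]
  · simp

/-- If `a ∧ βⁿ ≠ 0` then `βⁿ` does not vanish on bases of `ker a`. -/
theorem formPow_ne_zero_of_wedge (n : ℕ) (hV : Module.finrank ℝ V = 2 * n + 1)
    (a : V →ₗ[ℝ] ℝ) (β : V →ₗ[ℝ] V →ₗ[ℝ] ℝ) (ha : a ≠ 0)
    (ξ : Fin (2 * n) → V) (hξ : ∀ i, a (ξ i) = 0) (hli : LinearIndependent ℝ ξ)
    (hw : ∃ v, wedgeFormPow n (fun u => a u) (fun u w => β u w) v ≠ 0) :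
    formPow n (fun u w => β u w) ξ ≠ 0 := by
  intro h0
  obtain ⟨u, hu⟩ : ∃ u, a u ≠ 0 := by
    by_contra! h
    exact ha (LinearMap.ext h)
  have hli' : LinearIndependent ℝ (Fin.cons u ξ : Fin (2 * n + 1) → V) := by
    refine linearIndependent_finCons.2 ⟨hli, fun hmem => hu ?_⟩
    have : Submodule.span ℝ (range ξ) ≤ LinearMap.ker a := by
      rw [Submodule.span_le]
      rintro _ ⟨i, rfl⟩
      exact hξ i
    exact this hmem
  let b := basisOfLinearIndependentOfCardEqFinrank hli' (by simp [hV])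
  have hb : (b : Fin (2 * n + 1) → V) = Fin.cons u ξ :=
    coe_basisOfLinearIndependentOfCardEqFinrank _ _
  -- An alternating form of top degree is determined by its value on the single basis (u, ξ).
  have hz : wedgeFormPowAlt n a β = 0 := by
    rw [AlternatingMap.eq_smul_basis_det b (wedgeFormPowAlt n a β), hb, wedgeFormPowAlt_apply,
      wedgeFormPow_cons n a β u ξ hξ, h0, mul_zero, zero_smul]
  obtain ⟨v, hv⟩ := hw
  apply hv
  rw [← wedgeFormPowAlt_apply, hz]
  rfl

/-- If `βⁿ ≠ 0` on a basis then `β` is nondegenerate. -/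
theorem eq_zero_of_formPow_ne_zero {n : ℕ} (hn : 1 ≤ n) (hV : Module.finrank ℝ V = 2 * n)
    (β : V →ₗ[ℝ] V →ₗ[ℝ] ℝ) (hβ : ∀ v w, β v w = -β w v) (ξ : Fin (2 * n) → V)
    (hli : LinearIndependent ℝ ξ)
    (h : formPow n (fun u w => β u w) ξ ≠ 0) (v : V) (hv : ∀ w, β v w = 0) : v = 0 := by
  have : Nonempty (Fin (2 * n)) := ⟨⟨0, by omega⟩⟩
  let b := basisOfLinearIndependentOfCardEqFinrank hli (by simp [hV])
  have hb : (b : Fin (2 * n) → V) = ξ := coe_basisOfLinearIndependentOfCardEqFinrank _ _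
  by_contra hne
  obtain ⟨k, hk⟩ : ∃ k, b.repr v k ≠ 0 := by
    by_contra! h0
    exact hne (b.repr.map_eq_zero_iff.1 (Finsupp.ext h0))
  -- βⁿ is evaluated on ξ with ξ k replaced by v in two ways. Every product contains a factor
  -- pairing v with something, so the value is 0; expanding v in the basis gives its k-th coordinate
  -- times βⁿ(ξ), which is not 0.
  have h1 : formPowAlt n β (Function.update ξ k v) = 0 := by
    rw [formPowAlt_apply]
    unfold formPow
    rw [Finset.sum_eq_zero, mul_zero]
    intro σ _
    have hj : ((σ.symm k : Fin (2 * n)) : ℕ) / 2 < n := by omega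
    have hz : ∏ i : Fin n, β (Function.update ξ k v (σ ⟨2 * i, by omega⟩))
        (Function.update ξ k v (σ ⟨2 * i + 1, by omega⟩)) = 0 := by
      apply Finset.prod_eq_zero (Finset.mem_univ (⟨(σ.symm k : Fin (2 * n)) / 2, hj⟩ : Fin n))
      rcases Nat.even_or_odd' ((σ.symm k : Fin (2 * n)) : ℕ) with ⟨m, hm | hm⟩
      · have e1 : σ ⟨2 * ((σ.symm k : Fin (2 * n)) / 2), by omega⟩ = k := by
          rw [← Equiv.eq_symm_apply]
          exact Fin.ext (by simp only; omega)
        simp only [e1, Function.update_self, hv]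
      · have e1 : σ ⟨2 * ((σ.symm k : Fin (2 * n)) / 2) + 1, by omega⟩ = k := by
          rw [← Equiv.eq_symm_apply]
          exact Fin.ext (by simp only; omega)
        simp only [e1, Function.update_self]
        rw [hβ, hv, neg_zero]
    rw [hz, mul_zero]
  have h2 : formPowAlt n β (Function.update ξ k v) = b.repr v k * formPowAlt n β ξ := by
    have e := (formPowAlt n β).toMultilinearMap.toLinearMap ξ k
    have hs := b.sum_repr v
    rw [hb] at hs
    have : formPowAlt n β (Function.update ξ k v) =
        (formPowAlt n β).toMultilinearMap.toLinearMap ξ k v := rfl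
    rw [this]
    conv_lhs => rw [← hs, map_sum]
    rw [Finset.sum_eq_single k]
    · rw [map_smul, smul_eq_mul]
      simp
    · intro j _ hj
      rw [map_smul]
      have : (formPowAlt n β).toMultilinearMap.toLinearMap ξ k (ξ j) =
        formPowAlt n β (Function.update ξ k (ξ j)) := rfl
      rw [this, AlternatingMap.map_update_self _ _ hj.symm, smul_zero]
    · simp
  rw [h1, formPowAlt_apply] at h2
  exact (mul_ne_zero hk h) h2.symm

/-- The values of a top degree form on orthonormal frames. -/
theorem sq_alternating_eq_mul_det {m : ℕ} (hV : Module.finrank ℝ V = m)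
    (f : V [⋀^Fin m]→ₗ[ℝ] ℝ) (g : LinearMap.BilinForm ℝ V) (e : Fin m → V)
    (he : ∀ i j, g (e i) (e j) = if i = j then 1 else 0) (ξ : Fin m → V) :
    f ξ ^ 2 = f e ^ 2 * (Matrix.of fun i j => g (ξ i) (ξ j)).det := by
  have hli : LinearIndependent ℝ e := by
    rw [Fintype.linearIndependent_iff]
    intro c hc i
    have h := congrArg (g (e i)) hc
    simp only [map_sum, map_smul, he, map_zero] at h
    simpa using h
  rcases isEmpty_or_nonempty (Fin m) with hm | hm
  · rw [Subsingleton.elim ξ e, Matrix.det_isEmpty, mul_one]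
  let b := basisOfLinearIndependentOfCardEqFinrank hli (by simp [hV])
  have hb : (b : Fin m → V) = e := coe_basisOfLinearIndependentOfCardEqFinrank _ _
  have h1 : f ξ = f e * b.det ξ := by
    conv_lhs => rw [f.eq_smul_basis_det b, hb]
    rfl
  -- With T the coordinate matrix of ξ in the orthonormal basis e, the Gram matrix is TᵀT. Its
  -- determinant is (det T)², the square of the factor relating f ξ to f e.
  have h2 : (Matrix.of fun i j => g (ξ i) (ξ j)) = (b.toMatrix ξ).transpose * b.toMatrix ξ := by
    ext i j
    rw [Matrix.mul_apply, Matrix.of_apply]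
    have hs : ∀ j, ξ j = ∑ k, b.toMatrix ξ k j • e k := fun j => by
      conv_lhs => rw [← b.sum_repr (ξ j), hb]
      rfl
    conv_lhs => rw [hs i, hs j]
    simp only [map_sum, map_smul, LinearMap.sum_apply, LinearMap.smul_apply, he, smul_eq_mul,
      Matrix.transpose_apply, mul_ite, mul_one, mul_zero, Finset.sum_ite_eq',
      Finset.mem_univ, if_true]
    exact Finset.sum_congr rfl fun k _ => mul_comm _ _
  rw [h1, h2, Matrix.det_mul, Matrix.det_transpose, Module.Basis.det_apply]
  ring

theorem exists_orthonormal_frame {m : ℕ} [FiniteDimensional ℝ V] (hV : Module.finrank ℝ V = m)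
    (g : LinearMap.BilinForm ℝ V) (hs : ∀ u v, g u v = g v u) (hp : ∀ u, u ≠ 0 → 0 < g u u) :
    ∃ e : Fin m → V, ∀ i j, g (e i) (e j) = if i = j then 1 else 0 := by
  subst hV
  obtain ⟨v, hv⟩ := LinearMap.BilinForm.exists_orthogonal_basis (B := g) ⟨hs⟩
  have hvp : ∀ i, 0 < g (v i) (v i) := fun i => hp _ (v.ne_zero i)
  refine ⟨fun i => (Real.sqrt (g (v i) (v i)))⁻¹ • v i, fun i j => ?_⟩
  simp only [map_smul, LinearMap.smul_apply, smul_eq_mul]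
  split_ifs with h
  · subst h
    have h1 := Real.mul_self_sqrt (hvp i).le
    have h2 := (Real.sqrt_pos.2 (hvp i)).ne'
    field_simp
    rw [sq, h1]
  · rw [hv h]
    simp

/-- The Gram determinant of a linearly independent family is nonzero. -/
theorem gram_det_ne_zero {m : ℕ} (g : LinearMap.BilinForm ℝ V)
    (hp : ∀ u, u ≠ 0 → 0 < g u u) {ξ : Fin m → V} (hli : LinearIndependent ℝ ξ) :
    (Matrix.of fun i j => g (ξ i) (ξ j)).det ≠ 0 := by
  intro h0
  obtain ⟨c, hc, hc0⟩ := Matrix.exists_mulVec_eq_zero_iff.2 h0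
  apply hc
  have hz : ∑ j, c j • ξ j = 0 := by
    by_contra hne
    apply (hp _ hne).ne'
    have hk : ∀ k, g (ξ k) (∑ j, c j • ξ j) = 0 := fun k => by
      rw [map_sum, ← show _ = (0 : ℝ) from congrFun hc0 k]
      simp only [Matrix.mulVec, dotProduct, Matrix.of_apply, map_smul, smul_eq_mul]
      exact Finset.sum_congr rfl fun j _ => mul_comm _ _
    have hall : ∀ w, (∀ k, g (ξ k) w = 0) → g (∑ j, c j • ξ j) w = 0 := fun w hw => by
      simp [hw]
    exact hall _ hk
  funext j
  exact Fintype.linearIndependent_iff.1 hli c hz j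

end LinearAlgebra

/-! ### Smooth local defining forms of a corank one distribution. -/

section LocalForms

variable {E : Type*} [NormedAddCommGroup E] [NormedSpace ℝ E] [FiniteDimensional ℝ E]
  {H : Type*} [TopologicalSpace H] {I : ModelWithCorners ℝ E H}
  {M : Type*} [TopologicalSpace M] [ChartedSpace H M] [IsManifold I ∞ M]

omit [FiniteDimensional ℝ E] in
theorem SmoothFieldOn.sum_smul {ι : Type*} {s : Finset ι} {c : ι → M → ℝ}
    {X : ι → ∀ x : M, TangentSpace I x} {U : Set M}
    (hc : ∀ i ∈ s, ContMDiffOn I 𝓘(ℝ, ℝ) ∞ (c i) U) (hX : ∀ i ∈ s, SmoothFieldOn I (X i) U) :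
    SmoothFieldOn I (fun x => ∑ i ∈ s, c i x • X i x) U :=
  ContMDiffOn.sum_section fun i hi => (hc i hi).smul_section (hX i hi)

/-- A `1`-form is smooth if its values on smooth local fields are smooth. -/
theorem smoothFormOn_of_apply {α : ∀ x : M, TangentSpace I x →L[ℝ] ℝ} {U : Set M} (hU : IsOpen U)
    (h : ∀ (V : Set M) (X : ∀ x : M, TangentSpace I x), IsOpen V → V ⊆ U → SmoothFieldOn I X V →
      ContMDiffOn I 𝓘(ℝ, ℝ) ∞ (fun x => α x (X x)) V) :
    SmoothFormOn I α U := by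
  intro x₀ hx₀
  let b := Module.finBasis ℝ E
  let e := trivializationAt E (TangentSpace I) x₀
  have hfr := e.isLocalFrameOn_localFrame_baseSet I ∞ b
  have hVo : IsOpen (U ∩ e.baseSet) := hU.inter e.open_baseSet
  have hxV : x₀ ∈ U ∩ e.baseSet := ⟨hx₀, FiberBundle.mem_baseSet_trivializationAt' x₀⟩
  refine ContMDiffAt.contMDiffWithinAt ((contMDiffAt_hom_bundle _).2 ⟨contMDiffAt_id, ?_⟩)
  -- The coordinate covector of α is the combination of the dual basis whose coefficients are the
  -- values of α on the local frame.
  have hs : ContMDiffAt I 𝓘(ℝ, E →L[ℝ] ℝ) ∞ (fun y => ∑ k, (α y (e.localFrame b k y)) •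
      LinearMap.toContinuousLinearMap (b.coord k)) x₀ := by
    refine ContMDiffAt.sum fun k _ => ?_
    have hk := (h _ _ hVo inter_subset_left
      ((hfr.contMDiffOn k).mono inter_subset_right)).contMDiffAt (hVo.mem_nhds hxV)
    exact (ContinuousLinearMap.toSpanSingleton ℝ
      (LinearMap.toContinuousLinearMap (b.coord k))).contMDiff.contMDiffAt.comp x₀ hk
  refine hs.congr_of_eventuallyEq ?_
  filter_upwards [hVo.mem_nhds hxV] with y hy
  have h1 : ContinuousLinearMap.inCoordinates E (TangentSpace I) ℝ (fun _ : M => ℝ) x₀ y x₀ y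
      (α y) = (α y).comp (e.symmL ℝ y) := by
    ext v
    simp [ContinuousLinearMap.inCoordinates, e]
  refine h1.trans (ContinuousLinearMap.ext fun u => ?_)
  have h2 : ∀ k, e.localFrame b k y = e.symmL ℝ y (b k) := by
    intro k
    rw [e.localFrame_apply_of_mem_baseSet b hy.2]
    rw [e.symmL_apply hy.2]
    simp [Bundle.Trivialization.basisAt]
  have h3 : α y (e.symmL ℝ y u) = ∑ k, b.repr u k * α y (e.symmL ℝ y (b k)) := by
    conv_lhs => rw [← b.sum_repr u]
    rw [map_sum, map_sum]
    exact Finset.sum_congr rfl fun k _ => by rw [map_smul, map_smul, smul_eq_mul]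
  rw [ContinuousLinearMap.comp_apply, h3]
  simp [h2, mul_comm]

/-- The linear form `u ↦ det (u, η 0, …)`. -/
def detCons {m : ℕ} (η : Fin m → Fin (m + 1) → ℝ) : (Fin (m + 1) → ℝ) →ₗ[ℝ] ℝ where
  toFun u := Matrix.det (Matrix.vecCons u η)
  map_add' := AlternatingMap.map_vecCons_add (Matrix.detRowAlternating (R := ℝ)) η
  map_smul' := AlternatingMap.map_vecCons_smul (Matrix.detRowAlternating (R := ℝ)) η

theorem detCons_eq_zero_iff {m : ℕ} {η : Fin m → Fin (m + 1) → ℝ} (hη : LinearIndependent ℝ η)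
    (u : Fin (m + 1) → ℝ) : detCons η u = 0 ↔ u ∈ Submodule.span ℝ (range η) := by
  have h1 : detCons η u ≠ 0 ↔ LinearIndependent ℝ (Matrix.vecCons u η) := by
    rw [← isUnit_iff_ne_zero]
    refine (Matrix.isUnit_iff_isUnit_det _).symm.trans ?_
    exact Matrix.linearIndependent_rows_iff_isUnit.symm
  rw [← not_iff_not, ← ne_eq, h1]
  exact linearIndependent_finCons.trans (and_iff_right hη)

/-- A corank one distribution with a smooth frame is locally the kernel of a smooth `1`-form. -/
theorem exists_smoothForm_ker_eq_span {m : ℕ} (hE : Module.finrank ℝ E = m + 1) {U : Set M}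
    (hU : IsOpen U) {ξ : Fin m → ∀ x : M, TangentSpace I x} (hξ : ∀ i, SmoothFieldOn I (ξ i) U)
    (hli : ∀ x ∈ U, LinearIndependent ℝ (fun i => ξ i x)) {x₀ : M} (hx₀ : x₀ ∈ U) :
    ∃ V : Set M, IsOpen V ∧ V ⊆ U ∧ x₀ ∈ V ∧ ∃ α : ∀ x : M, TangentSpace I x →L[ℝ] ℝ,
      SmoothFormOn I α V ∧
      ∀ x ∈ V, ∀ v, α x v = 0 ↔ v ∈ Submodule.span ℝ (range fun i => ξ i x) := by
  let b := Module.finBasisOfFinrankEq ℝ E hE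
  let e := trivializationAt E (TangentSpace I) x₀
  have hfr := e.isLocalFrameOn_localFrame_baseSet I ∞ b
  have hVo : IsOpen (U ∩ e.baseSet) := hU.inter e.open_baseSet
  let R : ∀ x : M, TangentSpace I x →ₗ[ℝ] (Fin (m + 1) → ℝ) :=
    fun x => LinearMap.pi fun i => e.localFrameCoeff I b i x
  -- In frame coordinates α(v) = det(v, ξ 0, …), which vanishes exactly when v lies in the span of
  -- the ξ i. Passing through `modelEquiv` supplies continuity from the finite dimension of E.
  let α : ∀ x : M, TangentSpace I x →L[ℝ] ℝ := fun x =>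
    (LinearMap.toContinuousLinearMap ((detCons fun i => R x (ξ i x)).comp ((R x).comp
      (modelEquiv I x).symm.toLinearMap))).comp (modelEquiv I x).toContinuousLinearMap
  refine ⟨U ∩ e.baseSet, hVo, inter_subset_left,
    ⟨hx₀, FiberBundle.mem_baseSet_trivializationAt' x₀⟩, α, ?_, ?_⟩
  · refine smoothFormOn_of_apply hVo fun V X hV hVU hX x hx => ?_
    refine ContMDiffAt.contMDiffWithinAt ?_
    refine contMDiffAt_det (A := fun y => Matrix.vecCons (R y (X y)) fun i => R y (ξ i y))
      fun i j => ?_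
    refine Fin.cases ?_ (fun i => ?_) i
    · exact contMDiffAt_localFrameCoeff b (hVU hx).2
        (hX.contMDiffAt (hV.mem_nhds hx)) j
    · exact contMDiffAt_localFrameCoeff b (hVU hx).2
        ((hξ i).contMDiffAt (hU.mem_nhds (hVU hx).1)) j
  · intro x hx v
    have hR : R x = (e.basisAt b hx.2).equivFun.toLinearMap := by
      refine LinearMap.ext fun v => funext fun i => ?_
      have := e.localFrameCoeff_apply_of_mem_baseSet (I := I) b hx.2
        (fun y => (modelEquiv I y).symm (modelEquiv I x v)) i
      exact this
    have hinj : LinearMap.ker (R x) = ⊥ := by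
      rw [hR]
      exact LinearEquiv.ker _
    have hspan : Submodule.span ℝ (range fun i => R x (ξ i x)) =
        (Submodule.span ℝ (range fun i => ξ i x)).map (R x) := by
      rw [Submodule.map_span, ← range_comp]
      rfl
    have h1 : α x v = detCons (fun i => R x (ξ i x)) (R x v) := rfl
    have hη : LinearIndependent ℝ fun i => R x (ξ i x) := (hli x hx.1).map' (R x) hinj
    rw [h1, detCons_eq_zero_iff hη, hspan]
    constructor
    · rintro ⟨w, hw, hwv⟩
      rwa [LinearMap.ker_eq_bot.1 hinj hwv] at hw
    · exact fun h => Submodule.mem_map_of_mem h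

end LocalForms

/-! ### Restriction of domains and rescaling of forms. -/

section Differentials

variable {E : Type*} [NormedAddCommGroup E] [NormedSpace ℝ E]
  {H : Type*} [TopologicalSpace H] {I : ModelWithCorners ℝ E H}
  {M : Type*} [TopologicalSpace M] [ChartedSpace H M]

theorem SmoothFormOn.mono [IsManifold I 1 M] {α : ∀ x : M, TangentSpace I x →L[ℝ] ℝ} {U V : Set M}
    (h : SmoothFormOn I α U) (hVU : V ⊆ U) : SmoothFormOn I α V :=
  ContMDiffOn.mono h hVU

theorem SmoothFieldOn.mono [IsManifold I 1 M] {X : ∀ x : M, TangentSpace I x} {U V : Set M}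
    (h : SmoothFieldOn I X U) (hVU : V ⊆ U) : SmoothFieldOn I X V :=
  ContMDiffOn.mono h hVU

theorem differential_eq_zero_of_eventuallyEq {f : M → ℝ} {x : M} {c : ℝ}
    (h : f =ᶠ[𝓝 x] fun _ => c) : differential I f x = 0 := by
  unfold differential
  rw [h.mfderiv_eq, mfderiv_const]
  rfl

/-- A locally constant factor is what occurs between normalized contact forms, where it is ±1. A
variable factor would add a term dφ ∧ α, which does not vanish off the distribution. -/
theorem extDerivOne_of_eventuallyEq_smul [IsManifold I 1 M]
    {α β : ∀ x : M, TangentSpace I x →L[ℝ] ℝ} {x : M} {c : ℝ} [I.Boundaryless]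
    (hα : DifferentiableAt ℝ (chartForm I α x) (extChartAt I x x))
    (h : ∀ᶠ y in 𝓝 x, β y = c • α y) (v w : TangentSpace I x) :
    extDerivOne I β x v w = c * extDerivOne I α x v w := by
  have hev : chartForm I β x =ᶠ[𝓝 (extChartAt I x x)] fun q => c • chartForm I α x q := by
    have hc : Tendsto (extChartAt I x).symm (𝓝 (extChartAt I x x)) (𝓝 x) := by
      have := continuousAt_extChartAt_symm (I := I) x
      rwa [ContinuousAt, extChartAt_to_inv] at this
    filter_upwards [hc.eventually h] with q hq
    unfold chartForm
    rw [hq]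
    rfl
  rw [extDerivOne_eq_fderiv_chartForm hα, extDerivOne_eq_fderiv_chartForm
    ((hα.const_smul c).congr_of_eventuallyEq hev), hev.fderiv_eq, fderiv_fun_const_smul hα]
  simp only [smul_apply, smul_eq_mul]
  ring

theorem formPow_smul {V : Type*} (n : ℕ) (c : ℝ) (β : V → V → ℝ) (v : Fin (2 * n) → V) :
    formPow n (fun u w => c * β u w) v = c ^ n * formPow n β v := by
  unfold formPow
  rw [Finset.mul_sum, Finset.mul_sum, Finset.mul_sum]
  refine Finset.sum_congr rfl fun σ _ => ?_
  rw [Finset.prod_mul_distrib, Finset.prod_const, Finset.card_univ, Fintype.card_fin]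
  ring

end Differentials

/-! ### Contact forms of the distribution and nondegeneracy of dα on it. -/

namespace ContactSubRiemannian

variable {n : ℕ} {M : Type*} [TopologicalSpace M]
  [ChartedSpace (EuclideanSpace ℝ (Fin (2 * n + 1))) M] [IsManifold (𝓡 (2 * n + 1)) ∞ M]
  (S : ContactSubRiemannian n M)

/-- `X` is a smooth section of the distribution over `U`. -/
def SmoothSectionOn (X : ∀ x : M, S.plane x) (U : Set M) : Prop :=
  SmoothFieldOn (𝓡 (2 * n + 1)) (fun x => (X x : TangentSpace (𝓡 (2 * n + 1)) x)) U

/-- `α` is a smooth contact form of the distribution on the open set `U`. -/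
structure IsContactFormOn (U : Set M) (α : ∀ x : M, TangentSpace (𝓡 (2 * n + 1)) x →L[ℝ] ℝ) :
    Prop where
  isOpen : IsOpen U
  smooth : SmoothFormOn (𝓡 (2 * n + 1)) α U
  mem_plane_iff : ∀ x ∈ U, ∀ v : TangentSpace (𝓡 (2 * n + 1)) x, v ∈ S.plane x ↔ α x v = 0

/-- The restriction of `dα` to the distribution. -/
def planeForm (α : ∀ x : M, TangentSpace (𝓡 (2 * n + 1)) x →L[ℝ] ℝ) (x : M) :
    S.plane x →ₗ[ℝ] S.plane x →ₗ[ℝ] ℝ :=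
  (extDerivBilin (𝓡 (2 * n + 1)) α x).domRestrict₁₂ (S.plane x) (S.plane x)

variable {S}

theorem IsNormalizedContactForm.isContactFormOn {U : Set M}
    {α : ∀ x : M, TangentSpace (𝓡 (2 * n + 1)) x →L[ℝ] ℝ} (h : S.IsNormalizedContactForm U α) :
    S.IsContactFormOn U α :=
  ⟨h.1, h.2.1, fun x hx => (h.2.2 x hx).1⟩

theorem span_frame {x : M} {ξ : Fin (2 * n) → S.plane x} (h : LinearIndependent ℝ ξ) :
    Submodule.span ℝ (range fun i => (ξ i : TangentSpace (𝓡 (2 * n + 1)) x)) = S.plane x := by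
  have h1 := h.span_eq_top_of_card_eq_finrank' (by rw [S.finrank_plane, Fintype.card_fin])
  have h2 := congrArg (Submodule.map (S.plane x).subtype) h1
  rw [Submodule.map_span, ← range_comp, Submodule.map_top, Submodule.range_subtype] at h2
  exact h2

variable (S) in
-- A combination of the local frame with constant coefficients does it. Pointwise identities on Π
-- can then be checked on smooth sections.
theorem exists_section_through (x : M) (u : S.plane x) :
    ∃ U : Set M, IsOpen U ∧ x ∈ U ∧ ∃ Y : ∀ y : M, S.plane y, S.SmoothSectionOn Y U ∧ Y x = u := by
  obtain ⟨U, hU, hx, ξ, hξ, hli⟩ := S.exists_frame x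
  have hu : u ∈ Submodule.span ℝ (range fun i => ξ i x) := by
    rw [(hli x hx).span_eq_top_of_card_eq_finrank' (by rw [S.finrank_plane, Fintype.card_fin])]
    trivial
  obtain ⟨c, hc⟩ := (Submodule.mem_span_range_iff_exists_fun ℝ).1 hu
  refine ⟨U, hU, hx, fun y => ∑ i, c i • ξ i y, ?_, hc⟩
  have := SmoothFieldOn.sum_smul (s := Finset.univ) (c := fun i (_ : M) => c i) (U := U)
    (fun i _ => contMDiffOn_const) (fun i _ => hξ i)
  unfold SmoothSectionOn
  simpa using this

variable (S) in
theorem exists_contactForm (x₀ : M) :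
    ∃ U : Set M, x₀ ∈ U ∧ ∃ ξ : Fin (2 * n) → ∀ x : M, S.plane x,
      (∀ i, S.SmoothSectionOn (ξ i) U) ∧ (∀ x ∈ U, LinearIndependent ℝ fun i => ξ i x) ∧
      ∃ α : ∀ x : M, TangentSpace (𝓡 (2 * n + 1)) x →L[ℝ] ℝ, S.IsContactFormOn U α := by
  obtain ⟨U, hU, hx, ξ, hξ, hli⟩ := S.exists_frame x₀
  have hli' : ∀ x ∈ U, LinearIndependent ℝ
      fun i => (ξ i x : TangentSpace (𝓡 (2 * n + 1)) x) := fun x hx =>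
    (hli x hx).map' (S.plane x).subtype (Submodule.ker_subtype _)
  obtain ⟨V, hV, hVU, hxV, α, hα, hker⟩ := exists_smoothForm_ker_eq_span
    (by rw [finrank_euclideanSpace, Fintype.card_fin]) hU hξ hli' hx
  refine ⟨V, hxV, ξ, fun i => ContMDiffOn.mono (hξ i) hVU, fun x hx => hli x (hVU hx), α, hV, hα,
    fun x hx v => ?_⟩
  rw [hker x hx v, span_frame (hli x (hVU hx))]

section ContactForm

variable {U : Set M} {α : ∀ x : M, TangentSpace (𝓡 (2 * n + 1)) x →L[ℝ] ℝ}

theorem IsContactFormOn.apply_section (h : S.IsContactFormOn U α) {x : M} (hx : x ∈ U)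
    (u : S.plane x) : α x u = 0 := (h.mem_plane_iff x hx u).1 u.2

theorem IsContactFormOn.mono (h : S.IsContactFormOn U α) {V : Set M} (hV : IsOpen V) (hVU : V ⊆ U) :
    S.IsContactFormOn V α :=
  ⟨hV, h.smooth.mono hVU, fun x hx => h.mem_plane_iff x (hVU hx)⟩

/-- On sections `X`, `Y` of the distribution, `dα(X, Y) = -α([X, Y])`. -/
theorem extDerivOne_sections (hU : IsOpen U) (hα : SmoothFormOn (𝓡 (2 * n + 1)) α U)
    (hker : ∀ x ∈ U, ∀ v ∈ S.plane x, α x v = 0) {X Y : ∀ x : M, S.plane x}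
    {V : Set M} (hV : IsOpen V) (hX : S.SmoothSectionOn X V)
    (hY : S.SmoothSectionOn Y V) {x : M} (hx : x ∈ U) (hxV : x ∈ V) :
    extDerivOne (𝓡 (2 * n + 1)) α x (X x) (Y x) =
      -α x (mlieBracket (𝓡 (2 * n + 1)) (fun y => (X y : TangentSpace (𝓡 (2 * n + 1)) y))
        (fun y => (Y y : TangentSpace (𝓡 (2 * n + 1)) y)) x) := by
  have hz : ∀ Z : ∀ x : M, S.plane x,
      (fun y => α y (Z y : TangentSpace (𝓡 (2 * n + 1)) y)) =ᶠ[𝓝 x] fun _ => 0 := by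
    intro Z
    filter_upwards [hU.mem_nhds hx] with y hy
    exact hker y hy _ (Z y).2
  have := extDerivOne_apply_fields (hα.differentiableAt hU hx)
    (hX.mdifferentiableAt hV hxV) (hY.mdifferentiableAt hV hxV)
  rw [this, differential_eq_zero_of_eventuallyEq (hz X), differential_eq_zero_of_eventuallyEq (hz Y)]
  simp

/-- The term dφ ∧ α dies on Π. Since dβ(X, Y) = -β([X, Y]) on sections, the argument needs no
derivative of φ. -/
theorem extDerivOne_eq_mul_of_eq_smul (hU : IsOpen U) (hα : SmoothFormOn (𝓡 (2 * n + 1)) α U)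
    (hker : ∀ x ∈ U, ∀ v ∈ S.plane x, α x v = 0)
    {β : ∀ x : M, TangentSpace (𝓡 (2 * n + 1)) x →L[ℝ] ℝ} {φ : M → ℝ}
    (hβ : SmoothFormOn (𝓡 (2 * n + 1)) β U) (hφ : ∀ x ∈ U, ∀ v, β x v = φ x * α x v)
    {x : M} (hx : x ∈ U) (u w : S.plane x) :
    extDerivOne (𝓡 (2 * n + 1)) β x u w = φ x * extDerivOne (𝓡 (2 * n + 1)) α x u w := by
  obtain ⟨V, hV, hxV, X, hX, rfl⟩ := S.exists_section_through x u
  obtain ⟨W, hW, hxW, Y, hY, rfl⟩ := S.exists_section_through x w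
  have hX' : S.SmoothSectionOn X (V ∩ W) := ContMDiffOn.mono hX inter_subset_left
  have hY' : S.SmoothSectionOn Y (V ∩ W) := ContMDiffOn.mono hY inter_subset_right
  rw [extDerivOne_sections hU hα hker (hV.inter hW) hX' hY' hx ⟨hxV, hxW⟩,
    extDerivOne_sections hU hβ (fun y hy v hv => by rw [hφ y hy, hker y hy v hv, mul_zero])
      (hV.inter hW) hX' hY' hx ⟨hxV, hxW⟩, hφ x hx]
  ring

omit [IsManifold (𝓡 (2 * n + 1)) ∞ M] in
theorem finrank_tangent (x : M) :
    Module.finrank ℝ (TangentSpace (𝓡 (2 * n + 1)) x) = 2 * n + 1 :=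
  (finrank_euclideanSpace (𝕜 := ℝ) (ι := Fin (2 * n + 1))).trans (Fintype.card_fin _)

theorem IsContactFormOn.ne_zero (h : S.IsContactFormOn U α) {x : M} (hx : x ∈ U) : α x ≠ 0 := by
  intro h0
  have htop : S.plane x = ⊤ := by
    rw [eq_top_iff]
    intro v _
    rw [h.mem_plane_iff x hx, h0]
    rfl
  have := S.finrank_plane x
  rw [htop, finrank_top, finrank_tangent] at this
  omega

theorem IsContactFormOn.formPow_ne_zero (h : S.IsContactFormOn U α) {x : M} (hx : x ∈ U)
    {ξ : Fin (2 * n) → S.plane x} (hli : LinearIndependent ℝ ξ) :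
    formPow n (fun u w => S.planeForm α x u w) ξ ≠ 0 := by
  have hw := S.contact U α h.isOpen h.smooth
    (fun y hy => ⟨h.ne_zero hy, fun v hv => (h.mem_plane_iff y hy v).1 hv⟩) x hx
  refine formPow_ne_zero_of_wedge n (finrank_tangent x) (α x).toLinearMap
    (extDerivBilin (𝓡 (2 * n + 1)) α x) ?_
    (fun i => (ξ i : TangentSpace (𝓡 (2 * n + 1)) x)) (fun i => h.apply_section hx (ξ i))
    (hli.map' (S.plane x).subtype (Submodule.ker_subtype _)) hw
  intro h0
  exact h.ne_zero hx (ContinuousLinearMap.ext fun v => LinearMap.congr_fun h0 v)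

theorem IsContactFormOn.planeForm_nondegenerate (h : S.IsContactFormOn U α) (hn : 1 ≤ n) {x : M}
    (hx : x ∈ U) (v : S.plane x) (hv : ∀ w, S.planeForm α x v w = 0) : v = 0 := by
  let b := Module.finBasisOfFinrankEq ℝ (S.plane x) (S.finrank_plane x)
  exact eq_zero_of_formPow_ne_zero hn (S.finrank_plane x) (S.planeForm α x)
    (fun u w => extDerivOne_swap α x u w) b b.linearIndependent
    (h.formPow_ne_zero hx b.linearIndependent) v hv

end ContactForm

end ContactSubRiemannian

/-! ### Normalization of contact forms. -/

theorem contMDiffOn_formPow {E : Type*} [NormedAddCommGroup E] [NormedSpace ℝ E]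
    {H : Type*} [TopologicalSpace H] {I : ModelWithCorners ℝ E H}
    {M : Type*} [TopologicalSpace M] [ChartedSpace H M] {V : M → Type*} {U : Set M} (n : ℕ)
    {β : ∀ x : M, V x → V x → ℝ} {ξ : Fin (2 * n) → ∀ x : M, V x}
    (h : ∀ i j, ContMDiffOn I 𝓘(ℝ, ℝ) ∞ (fun x => β x (ξ i x) (ξ j x)) U) :
    ContMDiffOn I 𝓘(ℝ, ℝ) ∞ (fun x => formPow n (β x) fun i => ξ i x) U := by
  unfold formPow
  refine contMDiffOn_const.mul (contMDiffOn_finsetSum fun σ _ => ?_)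
  exact contMDiffOn_const.mul (contMDiffOn_finsetProd fun i _ => h _ _)

namespace ContactSubRiemannian

variable {n : ℕ} {M : Type*} [TopologicalSpace M]
  [ChartedSpace (EuclideanSpace ℝ (Fin (2 * n + 1))) M] [IsManifold (𝓡 (2 * n + 1)) ∞ M]
  (S : ContactSubRiemannian n M)

variable {S} {U : Set M} {α : ∀ x : M, TangentSpace (𝓡 (2 * n + 1)) x →L[ℝ] ℝ}

theorem IsContactFormOn.smul (h : S.IsContactFormOn U α) {φ : M → ℝ}
    (hφ : ContMDiffOn (𝓡 (2 * n + 1)) 𝓘(ℝ, ℝ) ∞ φ U) (h0 : ∀ x ∈ U, φ x ≠ 0) :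
    S.IsContactFormOn U (fun x => φ x • α x) := by
  refine ⟨h.isOpen, ?_, fun x hx v => ?_⟩
  · refine smoothFormOn_of_apply h.isOpen fun V X _ hVU hX => ?_
    exact (hφ.mono hVU).mul ((h.smooth.mono hVU).apply hX)
  · rw [h.mem_plane_iff x hx, smul_apply, smul_eq_mul, mul_eq_zero,
      or_iff_right (h0 x hx)]

theorem IsContactFormOn.formPow_of_eq_smul (h : S.IsContactFormOn U α)
    {β : ∀ x : M, TangentSpace (𝓡 (2 * n + 1)) x →L[ℝ] ℝ} {φ : M → ℝ}
    (hβ : SmoothFormOn (𝓡 (2 * n + 1)) β U) (hφ : ∀ x ∈ U, ∀ v, β x v = φ x * α x v)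
    {x : M} (hx : x ∈ U) (e : Fin (2 * n) → S.plane x) :
    formPow n (fun u w : S.plane x => extDerivOne (𝓡 (2 * n + 1)) β x u w) e =
      φ x ^ n * formPow n (fun u w : S.plane x => extDerivOne (𝓡 (2 * n + 1)) α x u w) e := by
  rw [← formPow_smul]
  congr 1
  funext u w
  exact extDerivOne_eq_mul_of_eq_smul h.isOpen h.smooth
    (fun y hy v hv => (h.mem_plane_iff y hy v).1 hv) hβ hφ hx u w

/-- The matrix of inner products of sections of the distribution. -/
def gram (S : ContactSubRiemannian n M) {m : ℕ} (ξ : Fin m → ∀ x : M, S.plane x) (x : M) :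
    Matrix (Fin m) (Fin m) ℝ :=
  Matrix.of fun i j => S.metric x (ξ i x) (ξ j x)

theorem contMDiffOn_gram (hU : IsOpen U) {m : ℕ} {ξ : Fin m → ∀ x : M, S.plane x}
    (hξ : ∀ i, S.SmoothSectionOn (ξ i) U) (i j : Fin m) :
    ContMDiffOn (𝓡 (2 * n + 1)) 𝓘(ℝ, ℝ) ∞ (fun x => S.gram ξ x i j) U :=
  S.metric_smooth U (ξ i) (ξ j) hU (hξ i) (hξ j)

theorem formPow_sq {x : M} {e : Fin (2 * n) → S.plane x}
    (he : ∀ i j, S.metric x (e i) (e j) = if i = j then 1 else 0)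
    (ξ : Fin (2 * n) → ∀ x : M, S.plane x) :
    formPow n (fun u w => S.planeForm α x u w) (fun i => ξ i x) ^ 2 =
      formPow n (fun u w => S.planeForm α x u w) e ^ 2 * (S.gram ξ x).det := by
  rw [← formPowAlt_apply, ← formPowAlt_apply]
  exact sq_alternating_eq_mul_det (S.finrank_plane x) _ (S.metric x) e he _

variable (S) in
-- Let f be the square of (dα)ⁿ on orthonormal frames. In a smooth frame ξ it equals (dα)ⁿ(ξ)² /
-- det(Gram ξ), so it is well defined, smooth and positive without choosing orthonormal frames
-- smoothly. Replacing α by φα multiplies (dα)ⁿ on Π by φⁿ, which dictates φ = f^(-1/(2n)).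
theorem exists_isNormalizedContactForm (hn : 1 ≤ n) (x₀ : M) :
    ∃ (U : Set M) (α : ∀ x : M, TangentSpace (𝓡 (2 * n + 1)) x →L[ℝ] ℝ), x₀ ∈ U ∧
      S.IsNormalizedContactForm U α := by
  obtain ⟨U, hx₀, ξ, hξ, hli, α, hα⟩ := S.exists_contactForm x₀
  let F : M → ℝ := fun x => formPow n (fun u w => S.planeForm α x u w) fun i => ξ i x
  let f : M → ℝ := fun x => F x ^ 2 * ((S.gram ξ x).det)⁻¹
  have hF : ContMDiffOn (𝓡 (2 * n + 1)) 𝓘(ℝ, ℝ) ∞ F U :=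
    contMDiffOn_formPow n fun i j => hα.smooth.extDerivOne hα.isOpen (hξ i) (hξ j)
  have hG0 : ∀ x ∈ U, (S.gram ξ x).det ≠ 0 := fun x hx =>
    gram_det_ne_zero (S.metric x) (S.metric_pos x) (hli x hx)
  have hfe : ∀ x ∈ U, ∀ e : Fin (2 * n) → S.plane x,
      (∀ i j, S.metric x (e i) (e j) = if i = j then 1 else 0) →
      f x = formPow n (fun u w => S.planeForm α x u w) e ^ 2 := by
    intro x hx e he
    have := formPow_sq (α := α) he ξ
    simp only [f, F]
    rw [this, mul_assoc, mul_inv_cancel₀ (hG0 x hx), mul_one]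
  have hf0 : ∀ x ∈ U, 0 < f x := by
    intro x hx
    obtain ⟨e, he⟩ := exists_orthonormal_frame (S.finrank_plane x) (S.metric x)
      (S.metric_symm x) (S.metric_pos x)
    have h1 : f x ≠ 0 := mul_ne_zero (pow_ne_zero 2 (hα.formPow_ne_zero hx (hli x hx)))
      (inv_ne_zero (hG0 x hx))
    have h2 := hfe x hx e he
    exact lt_of_le_of_ne (h2 ▸ sq_nonneg _) h1.symm
  let p : ℝ := -(1 / (2 * n))
  let φ : M → ℝ := fun x => f x ^ p
  have hφ : ContMDiffOn (𝓡 (2 * n + 1)) 𝓘(ℝ, ℝ) ∞ φ U := by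
    intro x hx
    have hU := hα.isOpen.mem_nhds hx
    have hG : ContMDiffAt (𝓡 (2 * n + 1)) 𝓘(ℝ, ℝ) ∞ (fun x => (S.gram ξ x).det) x :=
      contMDiffAt_det fun i j => (contMDiffOn_gram hα.isOpen hξ i j).contMDiffAt hU
    have hf : ContMDiffAt (𝓡 (2 * n + 1)) 𝓘(ℝ, ℝ) ∞ f x :=
      (((hF.contMDiffAt hU).pow 2)).mul (hG.inv₀ (hG0 x hx))
    have hr : ContDiffAt ℝ ∞ (fun t : ℝ => t ^ p) (f x) :=
      Real.contDiffAt_rpow_const_of_ne (hf0 x hx).ne'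
    exact (hr.contMDiffAt.comp x hf).contMDiffWithinAt
  have hβ := hα.smul hφ fun x hx => (Real.rpow_pos_of_pos (hf0 x hx) p).ne'
  refine ⟨U, _, hx₀, hα.isOpen, hβ.smooth, fun x hx => ⟨hβ.mem_plane_iff x hx, fun e he => ?_⟩⟩
  rw [hα.formPow_of_eq_smul hβ.smooth (φ := φ) (fun _ _ _ => rfl) hx e]
  have h1 := hfe x hx e he
  have h2 : φ x ^ n = (f x) ^ (-(1 / 2) : ℝ) := by
    simp only [φ]
    rw [← Real.rpow_natCast, ← Real.rpow_mul (hf0 x hx).le]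
    congr 1
    have : (n : ℝ) ≠ 0 := by positivity
    simp only [p]
    field_simp
  have h3 : f x = |formPow n (fun u w => S.planeForm α x u w) e| ^ (2 : ℝ) := by
    rw [h1, Real.rpow_two, sq_abs]
  have h4 : |formPow n (fun u w => S.planeForm α x u w) e| ≠ 0 := by
    intro h0
    have := hf0 x hx
    rw [h3, h0] at this
    norm_num at this
  rw [abs_mul, h2, abs_of_pos (Real.rpow_pos_of_pos (hf0 x hx) _), h3,
    ← Real.rpow_mul (abs_nonneg _)]
  norm_num
  rw [Real.rpow_neg_one]
  exact inv_mul_cancel₀ h4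

/-! ### Reeb fields -/

/-- The bilinear form `α ⊗ α + dα`, which is nondegenerate when `α` is a contact form. -/
def reebBilin (α : ∀ x : M, TangentSpace (𝓡 (2 * n + 1)) x →L[ℝ] ℝ) (x : M) :
    TangentSpace (𝓡 (2 * n + 1)) x →ₗ[ℝ] TangentSpace (𝓡 (2 * n + 1)) x →ₗ[ℝ] ℝ :=
  (α x).toLinearMap.smulRight (α x).toLinearMap + extDerivBilin (𝓡 (2 * n + 1)) α x

omit [IsManifold (𝓡 (2 * n + 1)) ∞ M] in
theorem reebBilin_apply (x : M) (v w : TangentSpace (𝓡 (2 * n + 1)) x) :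
    reebBilin α x v w = α x v * α x w + extDerivOne (𝓡 (2 * n + 1)) α x v w := rfl

/-- Testing on v itself gives α(v)² = 0, so v ∈ Π, where dα is nondegenerate. -/
theorem IsContactFormOn.reebBilin_nondegenerate (h : S.IsContactFormOn U α) (hn : 1 ≤ n) {x : M}
    (hx : x ∈ U) (v : TangentSpace (𝓡 (2 * n + 1)) x) (hv : ∀ w, reebBilin α x v w = 0) :
    v = 0 := by
  have h1 := hv v
  rw [reebBilin_apply, extDerivOne_self, add_zero, mul_self_eq_zero] at h1
  have hp : v ∈ S.plane x := (h.mem_plane_iff x hx v).2 h1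
  have := h.planeForm_nondegenerate hn hx ⟨v, hp⟩ fun w => by
    have := hv w
    rwa [reebBilin_apply, h1, zero_mul, zero_add] at this
  exact congrArg Subtype.val this

omit [IsManifold (𝓡 (2 * n + 1)) ∞ M] in
theorem reebBilin_eq_of_isReebVectorOf {x : M} {v : TangentSpace (𝓡 (2 * n + 1)) x}
    (hv : IsReebVectorOf α x v) (w : TangentSpace (𝓡 (2 * n + 1)) x) :
    reebBilin α x v w = α x w := by
  rw [reebBilin_apply, hv.1, hv.2, one_mul, add_zero]

theorem IsContactFormOn.isReebVectorOf_unique (h : S.IsContactFormOn U α) (hn : 1 ≤ n) {x : M}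
    (hx : x ∈ U) {v w : TangentSpace (𝓡 (2 * n + 1)) x} (hv : IsReebVectorOf α x v)
    (hw : IsReebVectorOf α x w) : v = w := by
  rw [← sub_eq_zero]
  refine h.reebBilin_nondegenerate hn hx _ fun u => ?_
  rw [map_sub, LinearMap.sub_apply, reebBilin_eq_of_isReebVectorOf hv,
    reebBilin_eq_of_isReebVectorOf hw, sub_self]

theorem IsContactFormOn.exists_isReebVectorOf (h : S.IsContactFormOn U α) (hn : 1 ≤ n) {x : M}
    (hx : x ∈ U) : ∃ v, IsReebVectorOf α x v := by
  have hfd : FiniteDimensional ℝ (TangentSpace (𝓡 (2 * n + 1)) x) :=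
    inferInstanceAs (FiniteDimensional ℝ (EuclideanSpace ℝ (Fin (2 * n + 1))))
  have hinj : Function.Injective (reebBilin α x) := by
    rw [injective_iff_map_eq_zero]
    exact fun v hv => h.reebBilin_nondegenerate hn hx v fun w => by rw [hv]; rfl
  have hsurj := (LinearMap.injective_iff_surjective_of_finrank_eq_finrank (f := reebBilin α x) (by
    rw [Module.finrank_linearMap, Module.finrank_self, mul_one])).1 hinj
  obtain ⟨v, hv⟩ := hsurj (α x).toLinearMap
  have hv' : ∀ w, α x v * α x w + extDerivOne (𝓡 (2 * n + 1)) α x v w = α x w := fun w => by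
    rw [← reebBilin_apply, hv]
    rfl
  -- Evaluating on v gives α(v)² = α(v). If α(v) = 0, then v ∈ Π and dα(v, ·) = 0 on Π, so v = 0 and
  -- the equation would give α = 0.
  have h1 : α x v = 1 := by
    have h2 := hv' v
    rw [extDerivOne_self, add_zero] at h2
    by_contra hne
    have h0 : α x v = 0 := by
      rcases mul_eq_zero.1 (show α x v * (α x v - 1) = 0 by linarith) with h3 | h3
      · exact h3
      · exact absurd (by linarith) hne
    have hz := h.planeForm_nondegenerate hn hx ⟨v, (h.mem_plane_iff x hx v).2 h0⟩ fun w => by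
      have h3 := hv' w
      rw [h0, zero_mul, zero_add, h.apply_section hx w] at h3
      exact h3
    have hz' : v = 0 := congrArg Subtype.val hz
    refine h.ne_zero hx (ContinuousLinearMap.ext fun w => ?_)
    rw [← hv' w, ← extDerivBilin_apply, hz']
    simp
  exact ⟨v, h1, fun w => by have := hv' w; rw [h1] at this; linarith⟩

/-- The two Reeb conditions imply the single linear system (α ⊗ α + dα)(ν, ·) = α, nondegenerate
with smooth coefficients. Hence Reeb fields given only pointwise are automatically smooth. -/
theorem IsContactFormOn.smooth_reeb (h : S.IsContactFormOn U α) (hn : 1 ≤ n)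
    {ν : ∀ x : M, TangentSpace (𝓡 (2 * n + 1)) x} (hν : ∀ x ∈ U, IsReebVectorOf α x (ν x)) :
    SmoothFieldOn (𝓡 (2 * n + 1)) ν U := by
  refine smoothFieldOn_of_bilin h.isOpen (B := reebBilin α) (θ := fun x => (α x).toLinearMap)
    (fun x hx v hv => h.reebBilin_nondegenerate hn hx v hv) ?_ ?_
    (fun x hx w => reebBilin_eq_of_isReebVectorOf (hν x hx) w)
  · intro V X Y hV hVU hX hY
    have hs : SmoothFormOn (𝓡 (2 * n + 1)) α V := h.smooth.mono hVU
    exact ((hs.apply hX).mul (hs.apply hY)).add (hs.extDerivOne hV hX hY)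
  · intro V Y _ hVU hY
    exact (h.smooth.mono hVU).apply hY

theorem IsContactFormOn.exists_reeb (h : S.IsContactFormOn U α) (hn : 1 ≤ n) :
    ∃ ν : ∀ x : M, TangentSpace (𝓡 (2 * n + 1)) x, ∀ x ∈ U, IsReebVectorOf α x (ν x) := by
  have : ∀ x : M, ∃ v, x ∈ U → IsReebVectorOf α x v := by
    intro x
    by_cases hx : x ∈ U
    · exact (h.exists_isReebVectorOf hn hx).imp fun _ hv _ => hv
    · exact ⟨0, fun h => absurd h hx⟩
  choose ν hν using this
  exact ⟨ν, hν⟩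

/-- Reeb vectors of normalized contact forms are unique up to sign. -/
theorem IsReebVector.eq_or_eq_neg (hn : 1 ≤ n) {x : M} {v w : TangentSpace (𝓡 (2 * n + 1)) x}
    (hv : S.IsReebVector x v) (hw : S.IsReebVector x w) : w = v ∨ w = -v := by
  obtain ⟨U, α, hxU, hα, hvα⟩ := hv
  obtain ⟨V, β, hxV, hβ, hwβ⟩ := hw
  have hW : IsOpen (U ∩ V) := hα.1.inter hβ.1
  have hcα := hα.isContactFormOn.mono hW inter_subset_left
  have hcβ := hβ.isContactFormOn.mono hW inter_subset_right
  obtain ⟨ν, hν⟩ := hcα.exists_reeb hn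
  have hx : x ∈ U ∩ V := ⟨hxU, hxV⟩
  -- Both forms have kernel Π, so β is a multiple of α; evaluating on the Reeb field of α identifies
  -- the factor.
  let c : M → ℝ := fun y => β y (ν y)
  have hc : ContMDiffOn (𝓡 (2 * n + 1)) 𝓘(ℝ, ℝ) ∞ c (U ∩ V) :=
    hcβ.smooth.apply (hcα.smooth_reeb hn hν)
  have hβc : ∀ y ∈ U ∩ V, ∀ u, β y u = c y * α y u := by
    intro y hy u
    have h1 : u - α y u • ν y ∈ S.plane y := by
      rw [hcα.mem_plane_iff y hy, map_sub, map_smul, (hν y hy).1, smul_eq_mul, mul_one, sub_self]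
    rw [hcβ.mem_plane_iff y hy, map_sub, map_smul, smul_eq_mul] at h1
    simp only [c]
    linarith
  -- On orthonormal frames (dβ)ⁿ = cⁿ (dα)ⁿ and both are ±1, so |c|ⁿ = 1.
  have habs : ∀ y ∈ U ∩ V, |c y| = 1 := by
    intro y hy
    obtain ⟨e, he⟩ := exists_orthonormal_frame (S.finrank_plane y) (S.metric y)
      (S.metric_symm y) (S.metric_pos y)
    have h1 := (hβ.2.2 y hy.2).2 e he
    rw [hcα.formPow_of_eq_smul hcβ.smooth hβc hy e, abs_mul, (hα.2.2 y hy.1).2 e he, mul_one,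
      abs_pow] at h1
    exact (pow_eq_one_iff_of_nonneg (abs_nonneg _) (by omega)).1 h1
  -- A continuous function with values ±1 is locally constant: distinct values are at distance 2.
  have hev : ∀ᶠ y in 𝓝 x, c y = c x := by
    have hcont : ContinuousAt c x := hc.continuousOn.continuousAt (hW.mem_nhds hx)
    have hd : ∀ᶠ y in 𝓝 x, |c y - c x| < 1 := by
      have := Metric.continuousAt_iff'.1 hcont 1 one_pos
      simpa [Real.dist_eq] using this
    filter_upwards [hd, hW.mem_nhds hx] with y hy hyW
    rcases eq_or_eq_neg_of_abs_eq (habs y hyW) with h1 | h1 <;>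
      rcases eq_or_eq_neg_of_abs_eq (habs x hx) with h2 | h2 <;> rw [h1, h2] at hy ⊢ <;>
      norm_num at hy
  have hsq : c x * c x = 1 := by
    rw [← abs_mul_abs_self, habs x hx, one_mul]
  have hd : ∀ u, extDerivOne (𝓡 (2 * n + 1)) β x v u = 0 := by
    intro u
    have h1 : ∀ᶠ y in 𝓝 x, β y = c x • α y := by
      filter_upwards [hev, hW.mem_nhds hx] with y hy hyW
      exact ContinuousLinearMap.ext fun u => by rw [hβc y hyW, hy]; rfl
    rw [extDerivOne_of_eventuallyEq_smul (hcα.smooth.differentiableAt hW hx) h1, hvα.2, mul_zero]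
  have hr : IsReebVectorOf β x (c x • v) := by
    constructor
    · rw [map_smul, hβc x hx, hvα.1, smul_eq_mul, mul_one, hsq]
    · intro u
      rw [← extDerivBilin_apply, map_smul, LinearMap.smul_apply, extDerivBilin_apply, hd, smul_zero]
  have hw := hcβ.isReebVectorOf_unique hn hx hwβ hr
  rcases eq_or_eq_neg_of_abs_eq (habs x hx) with h1 | h1
  · left
    rw [hw, h1, one_smul]
  · right
    rw [hw, h1, neg_one_smul]

end ContactSubRiemannian

/-! ### Critical points and differentiation rules. -/

section LocalMin

variable {E : Type*} [NormedAddCommGroup E] [NormedSpace ℝ E]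
  {H : Type*} [TopologicalSpace H] {I : ModelWithCorners ℝ E H}
  {M : Type*} [TopologicalSpace M] [ChartedSpace H M]

/-- Fermat's theorem in a chart; where f is not differentiable, `mfderiv` is zero by convention. -/
theorem differential_eq_zero_of_isLocalMin [I.Boundaryless] {f : M → ℝ} {x : M} (h : IsLocalMin f x) :
    differential I f x = 0 := by
  unfold differential
  by_cases hd : MDifferentiableAt I 𝓘(ℝ, ℝ) f x
  · have h0 : fderiv ℝ (writtenInExtChartAt I 𝓘(ℝ, ℝ) x f) (extChartAt I x x) = 0 := by
      refine IsLocalMin.fderiv_eq_zero ?_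
      have hc : Tendsto (extChartAt I x).symm (𝓝 (extChartAt I x x)) (𝓝 x) := by
        have := continuousAt_extChartAt_symm (I := I) x
        rwa [ContinuousAt, extChartAt_to_inv] at this
      refine (hc.eventually h).mono fun q hq => ?_
      have e : ∀ r, writtenInExtChartAt I 𝓘(ℝ, ℝ) x f r = f ((extChartAt I x).symm r) :=
        fun _ => rfl
      rwa [e, e, extChartAt_to_inv]
    rw [hd.mfderiv, I.range_eq_univ, fderivWithin_univ, h0]
    rfl
  · exact mfderiv_zero_of_not_mdifferentiableAt hd

theorem differential_sq {f : M → ℝ} {x : M} (hf : MDifferentiableAt I 𝓘(ℝ, ℝ) f x)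
    (v : TangentSpace I x) :
    differential I (fun y => f y ^ 2) x v = 2 * f x * differential I f x v := by
  have h0 : HasDerivAt (fun t : ℝ => t ^ 2) (2 * f x) (f x) := by
    simpa using hasDerivAt_pow 2 (f x)
  have h1 : HasMFDerivAt 𝓘(ℝ, ℝ) 𝓘(ℝ, ℝ) (fun t : ℝ => t ^ 2) (f x)
      (ContinuousLinearMap.toSpanSingleton ℝ (2 * f x)) := h0.hasFDerivAt.hasMFDerivAt
  have h2 := (HasMFDerivAt.comp x h1 hf.hasMFDerivAt).mfderiv
  have h3 : differential I (fun y => f y ^ 2) x = (ContinuousLinearMap.toSpanSingleton ℝ (2 * f x)).comp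
    (differential I f x) := h2
  rw [h3]
  simp [mul_comm]

theorem differential_add {f g : M → ℝ} {x : M} (hf : MDifferentiableAt I 𝓘(ℝ, ℝ) f x)
    (hg : MDifferentiableAt I 𝓘(ℝ, ℝ) g x) :
    differential I (fun y => f y + g y) x = differential I f x + differential I g x :=
  (hf.hasMFDerivAt.add hg.hasMFDerivAt).mfderiv

theorem differential_const_mul {f : M → ℝ} {x : M} (c : ℝ)
    (hf : MDifferentiableAt I 𝓘(ℝ, ℝ) f x) :
    differential I (fun y => c * f y) x = c • differential I f x :=
  (hf.hasMFDerivAt.const_smul c).mfderiv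

end LocalMin

/-! ### The derivative of the Reeb momentum along the geodesic flow, and the two implications. -/

namespace ContactSubRiemannian

variable {n : ℕ} {M : Type*} [TopologicalSpace M]
  [ChartedSpace (EuclideanSpace ℝ (Fin (2 * n + 1))) M] [IsManifold (𝓡 (2 * n + 1)) ∞ M]
  {S : ContactSubRiemannian n M}

variable {U : Set M} {α : ∀ x : M, TangentSpace (𝓡 (2 * n + 1)) x →L[ℝ] ℝ}
  {ν : ∀ x : M, TangentSpace (𝓡 (2 * n + 1)) x}

theorem IsNormalizedContactForm.mono (h : S.IsNormalizedContactForm U α) {V : Set M}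
    (hV : IsOpen V) (hVU : V ⊆ U) : S.IsNormalizedContactForm V α :=
  ⟨hV, h.2.1.mono hVU, fun x hx => h.2.2 x (hVU hx)⟩

/-- The chosen Reeb vector may change sign from point to point; the square removes this, so I_g is
locally the square of the momentum of a smooth field. -/
theorem reebMomentum_eq (hn : 1 ≤ n) (hα : S.IsNormalizedContactForm U α)
    (hν : ∀ x ∈ U, IsReebVectorOf α x (ν x)) {ζ : CotangentBundle (𝓡 (2 * n + 1)) M}
    (hζ : ζ.1 ∈ U) : S.reebMomentum ζ = momentum ν ζ ^ 2 := by
  have h1 : S.IsReebVector ζ.1 (ν ζ.1) := ⟨U, α, hζ, hα, hν _ hζ⟩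
  have h2 := Classical.epsilon_spec (⟨_, h1⟩ : ∃ v, S.IsReebVector ζ.1 v)
  unfold reebMomentum momentum
  rcases h1.eq_or_eq_neg hn h2 with h3 | h3
  · rw [h3]
  · rw [h3, map_neg, neg_sq]

theorem isOpen_proj_preimage (hU : IsOpen U) :
    IsOpen ((fun ζ : CotangentBundle (𝓡 (2 * n + 1)) M => ζ.1) ⁻¹' U) :=
  hU.preimage (FiberBundle.continuous_proj _ _)

theorem mdifferentiableAt_momentum (hU : IsOpen U) (hν : SmoothFieldOn (𝓡 (2 * n + 1)) ν U)
    {ζ : CotangentBundle (𝓡 (2 * n + 1)) M} (hζ : ζ.1 ∈ U) :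
    MDifferentiableAt (cotangentModel (𝓡 (2 * n + 1))) 𝓘(ℝ, ℝ) (momentum ν) ζ :=
  ((contMDiffOn_momentum hν).contMDiffAt ((isOpen_proj_preimage hU).mem_nhds hζ)).mdifferentiableAt
    (by simp)

theorem contMDiffAt_reebMomentum (S : ContactSubRiemannian n M) (hn : 1 ≤ n)
    (ζ : CotangentBundle (𝓡 (2 * n + 1)) M) :
    ContMDiffAt (cotangentModel (𝓡 (2 * n + 1))) 𝓘(ℝ, ℝ) ∞ S.reebMomentum ζ := by
  obtain ⟨U, α, hx, hα⟩ := S.exists_isNormalizedContactForm hn ζ.1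
  obtain ⟨ν, hν⟩ := hα.isContactFormOn.exists_reeb hn
  have h1 := (contMDiffOn_momentum (hα.isContactFormOn.smooth_reeb hn hν)).contMDiffAt
    ((isOpen_proj_preimage hα.1).mem_nhds hx)
  refine (h1.pow 2).congr_of_eventuallyEq ?_
  filter_upwards [(isOpen_proj_preimage hα.1).mem_nhds hx] with ξ hξ
  exact reebMomentum_eq hn hα hν hξ

theorem metric_sharp (x : M) (p : TangentSpace (𝓡 (2 * n + 1)) x →L[ℝ] ℝ) (w : S.plane x) :
    S.metric x (S.sharp x p) w = p w := by
  unfold sharp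
  rw [LinearMap.BilinForm.apply_toDual_symm_apply]
  rfl

theorem sharp_eq_of_forall {x : M} {p : TangentSpace (𝓡 (2 * n + 1)) x →L[ℝ] ℝ} {u : S.plane x}
    (h : ∀ w : S.plane x, p w = S.metric x u w) : S.sharp x p = u := by
  rw [← sub_eq_zero]
  refine (S.metric_nondegenerate x).1 _ fun w => ?_
  rw [map_sub, LinearMap.sub_apply, metric_sharp, h, sub_self]

/-- With G the Gram matrix and P the momenta of the frame, H = ½ Pᵀ G⁻¹ P. This formula shows that H
is smooth. -/
theorem hamiltonian_eq_sum {ξ : Fin (2 * n) → ∀ x : M, S.plane x}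
    (ζ : CotangentBundle (𝓡 (2 * n + 1)) M) (hli : LinearIndependent ℝ fun i => ξ i ζ.1) :
    S.hamiltonian ζ = (1 / 2) * ∑ i, (∑ j, (S.gram ξ ζ.1)⁻¹ i j *
      momentum (fun x => (ξ j x : TangentSpace (𝓡 (2 * n + 1)) x)) ζ) *
        momentum (fun x => (ξ i x : TangentSpace (𝓡 (2 * n + 1)) x)) ζ := by
  set P : Fin (2 * n) → ℝ :=
    fun i => momentum (fun x => (ξ i x : TangentSpace (𝓡 (2 * n + 1)) x)) ζ with hP
  have hG : (S.gram ξ ζ.1).det ≠ 0 := gram_det_ne_zero _ (S.metric_pos ζ.1) hli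
  obtain ⟨c, hc⟩ : ∃ c : Fin (2 * n) → ℝ, ∑ i, c i • ξ i ζ.1 = S.sharp ζ.1 ζ.2 := by
    rw [← Submodule.mem_span_range_iff_exists_fun,
      hli.span_eq_top_of_card_eq_finrank' (by rw [S.finrank_plane, Fintype.card_fin])]
    trivial
  have hsys : (S.gram ξ ζ.1).mulVec c = P := by
    funext j
    have h1 : P j = S.metric ζ.1 (ξ j ζ.1) (S.sharp ζ.1 ζ.2) := by
      rw [S.metric_symm, metric_sharp]
      rfl
    rw [h1, ← hc]
    simp only [Matrix.mulVec, dotProduct, gram, Matrix.of_apply, map_sum, map_smul, smul_eq_mul]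
    exact Finset.sum_congr rfl fun i _ => mul_comm _ _
  have hc' : c = (S.gram ξ ζ.1)⁻¹.mulVec P := by
    rw [← hsys, Matrix.mulVec_mulVec, Matrix.nonsing_inv_mul _ (Ne.isUnit hG), Matrix.one_mulVec]
  have h2 : S.metric ζ.1 (S.sharp ζ.1 ζ.2) (S.sharp ζ.1 ζ.2) = ∑ i, c i * P i := by
    rw [metric_sharp, ← hc]
    simp [hP, momentum]
  unfold hamiltonian
  rw [h2]
  congr 1
  refine Finset.sum_congr rfl fun i _ => ?_
  conv_lhs => rw [hc']
  rfl

theorem contMDiff_hamiltonian (S : ContactSubRiemannian n M) :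
    ContMDiff (cotangentModel (𝓡 (2 * n + 1))) 𝓘(ℝ, ℝ) ∞ S.hamiltonian := by
  intro ζ
  obtain ⟨U, hU, hx, ξ, hξ, hli⟩ := S.exists_frame ζ.1
  have hπ := (isOpen_proj_preimage hU).mem_nhds hx
  have hP : ∀ i, ContMDiffAt (cotangentModel (𝓡 (2 * n + 1))) 𝓘(ℝ, ℝ) ∞
      (momentum fun x => (ξ i x : TangentSpace (𝓡 (2 * n + 1)) x)) ζ := fun i =>
    (contMDiffOn_momentum (hξ i)).contMDiffAt hπ
  have hG : ∀ i j, ContMDiffAt (cotangentModel (𝓡 (2 * n + 1))) 𝓘(ℝ, ℝ) ∞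
      (fun ζ : CotangentBundle (𝓡 (2 * n + 1)) M => (S.gram ξ ζ.1)⁻¹ i j) ζ := by
    intro i j
    have h1 := contMDiffAt_inv_apply
      (fun i j => (contMDiffOn_gram hU hξ i j).contMDiffAt (hU.mem_nhds hx))
      (gram_det_ne_zero _ (S.metric_pos ζ.1) (hli _ hx)) i j
    exact ContMDiffAt.comp ζ h1 (Bundle.contMDiffAt_proj _)
  have hs : ContMDiffAt (cotangentModel (𝓡 (2 * n + 1))) 𝓘(ℝ, ℝ) ∞
      (fun ζ : CotangentBundle (𝓡 (2 * n + 1)) M => (1 / 2 : ℝ) * ∑ i, (∑ j,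
        (S.gram ξ ζ.1)⁻¹ i j *
          momentum (fun x => (ξ j x : TangentSpace (𝓡 (2 * n + 1)) x)) ζ) *
        momentum (fun x => (ξ i x : TangentSpace (𝓡 (2 * n + 1)) x)) ζ) ζ :=
    contMDiffAt_const.mul (ContMDiffAt.sum fun i _ =>
      (ContMDiffAt.sum fun j _ => (hG i j).mul (hP j)).mul (hP i))
  refine hs.congr_of_eventuallyEq ?_
  filter_upwards [hπ] with η hη
  exact hamiltonian_eq_sum η (hli _ hη)

/-- Completing the square: the right side is ½ g(`sharp` p - Y, `sharp` p - Y). -/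
theorem le_hamiltonian (Y : ∀ x : M, S.plane x) (ζ : CotangentBundle (𝓡 (2 * n + 1)) M) :
    0 ≤ S.hamiltonian ζ + ((-1) * momentum (fun x => (Y x : TangentSpace (𝓡 (2 * n + 1)) x)) ζ +
      (1 / 2) * S.metric ζ.1 (Y ζ.1) (Y ζ.1)) := by
  have h1 : 0 ≤ S.metric ζ.1 (S.sharp ζ.1 ζ.2 - Y ζ.1) (S.sharp ζ.1 ζ.2 - Y ζ.1) := by
    by_cases h0 : S.sharp ζ.1 ζ.2 - Y ζ.1 = 0
    · rw [h0]
      simp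
    · exact (S.metric_pos _ _ h0).le
  have h2 : momentum (fun x => (Y x : TangentSpace (𝓡 (2 * n + 1)) x)) ζ =
      S.metric ζ.1 (S.sharp ζ.1 ζ.2) (Y ζ.1) := (metric_sharp _ _ _).symm
  simp only [map_sub, LinearMap.sub_apply, S.metric_symm ζ.1 (Y ζ.1) (S.sharp ζ.1 ζ.2)] at h1
  rw [h2]
  unfold hamiltonian
  linarith

/-- The Hamiltonian has the same differential at `ζ` as `p ↦ p(Y) - g(Y, Y) / 2` for a section `Y`
of the distribution dual to `ζ`. -/
theorem differential_hamiltonian (hU : IsOpen U) {Y : ∀ x : M, S.plane x}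
    (hY : S.SmoothSectionOn Y U) {ζ : CotangentBundle (𝓡 (2 * n + 1)) M} (hζ : ζ.1 ∈ U)
    (hYζ : Y ζ.1 = S.sharp ζ.1 ζ.2)
    (w : TangentSpace (cotangentModel (𝓡 (2 * n + 1))) ζ) :
    differential (cotangentModel (𝓡 (2 * n + 1))) S.hamiltonian ζ w =
      differential (cotangentModel (𝓡 (2 * n + 1)))
        (momentum fun x => (Y x : TangentSpace (𝓡 (2 * n + 1)) x)) ζ w -
      (1 / 2) * differential (cotangentModel (𝓡 (2 * n + 1)))
        (fun ξ : CotangentBundle (𝓡 (2 * n + 1)) M => S.metric ξ.1 (Y ξ.1) (Y ξ.1)) ζ w := by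
  have hH : MDifferentiableAt (cotangentModel (𝓡 (2 * n + 1))) 𝓘(ℝ, ℝ) S.hamiltonian ζ :=
    (S.contMDiff_hamiltonian ζ).mdifferentiableAt (by simp)
  have hP := mdifferentiableAt_momentum hU hY hζ
  have hg : MDifferentiableAt (cotangentModel (𝓡 (2 * n + 1))) 𝓘(ℝ, ℝ)
      (fun ξ : CotangentBundle (𝓡 (2 * n + 1)) M => S.metric ξ.1 (Y ξ.1) (Y ξ.1)) ζ := by
    have h1 := (S.metric_smooth U Y Y hU hY hY).contMDiffAt (hU.mem_nhds hζ)
    exact (ContMDiffAt.comp ζ h1 (Bundle.contMDiffAt_proj _)).mdifferentiableAt (by simp)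
  -- This function is nonnegative everywhere and zero at ζ because Y equals `sharp` p there. A
  -- minimum is critical, so `sharp` never has to be differentiated.
  have h0 := differential_eq_zero_of_isLocalMin (I := cotangentModel (𝓡 (2 * n + 1)))
    (f := fun ζ => S.hamiltonian ζ +
      ((-1) * momentum (fun x => (Y x : TangentSpace (𝓡 (2 * n + 1)) x)) ζ +
      (1 / 2) * S.metric ζ.1 (Y ζ.1) (Y ζ.1))) (x := ζ) (by
    refine Eventually.of_forall fun ξ => le_of_eq_of_le ?_ (le_hamiltonian Y ξ)
    have h2 : momentum (fun x => (Y x : TangentSpace (𝓡 (2 * n + 1)) x)) ζ =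
        S.metric ζ.1 (S.sharp ζ.1 ζ.2) (Y ζ.1) := (metric_sharp _ _ _).symm
    simp only
    rw [h2, hYζ]
    unfold hamiltonian
    ring)
  have hP' : MDifferentiableAt (cotangentModel (𝓡 (2 * n + 1))) 𝓘(ℝ, ℝ)
      (fun ζ => (-1) * momentum (fun x => (Y x : TangentSpace (𝓡 (2 * n + 1)) x)) ζ) ζ :=
    (hP.hasMFDerivAt.const_smul (-1 : ℝ)).mdifferentiableAt
  have hg' : MDifferentiableAt (cotangentModel (𝓡 (2 * n + 1))) 𝓘(ℝ, ℝ)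
      (fun ξ : CotangentBundle (𝓡 (2 * n + 1)) M => (1 / 2) * S.metric ξ.1 (Y ξ.1) (Y ξ.1)) ζ :=
    (hg.hasMFDerivAt.const_smul (1 / 2 : ℝ)).mdifferentiableAt
  have hPg : MDifferentiableAt (cotangentModel (𝓡 (2 * n + 1))) 𝓘(ℝ, ℝ)
      (fun ζ : CotangentBundle (𝓡 (2 * n + 1)) M =>
        (-1) * momentum (fun x => (Y x : TangentSpace (𝓡 (2 * n + 1)) x)) ζ +
          (1 / 2) * S.metric ζ.1 (Y ζ.1) (Y ζ.1)) ζ :=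
    (hP'.hasMFDerivAt.add hg'.hasMFDerivAt).mdifferentiableAt
  rw [differential_add hH hPg, differential_add hP' hg', differential_const_mul _ hP,
    differential_const_mul _ hg] at h0
  have h1 := DFunLike.congr_fun h0 w
  simp only [add_apply, smul_apply, smul_eq_mul, zero_apply] at h1
  linarith

/-- The bracket of the Reeb field with a section of the distribution is tangent to it. -/
theorem IsContactFormOn.mlieBracket_reeb_mem (h : S.IsContactFormOn U α) (hn : 1 ≤ n)
    (hν : ∀ x ∈ U, IsReebVectorOf α x (ν x)) {Y : ∀ x : M, S.plane x}
    (hY : S.SmoothSectionOn Y U) {x : M} (hx : x ∈ U) :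
    mlieBracket (𝓡 (2 * n + 1)) ν (fun y => (Y y : TangentSpace (𝓡 (2 * n + 1)) y)) x ∈
      S.plane x := by
  -- In Cartan's formula α(Y) = 0 and α(ν) = 1 are locally constant and dα(ν, ·) = 0, which leaves
  -- α([ν, Y]) = 0.
  have h1 := extDerivOne_apply_fields (h.smooth.differentiableAt h.isOpen hx)
    ((h.smooth_reeb hn hν).mdifferentiableAt h.isOpen hx) (hY.mdifferentiableAt h.isOpen hx)
  have h2 : (fun y => α y (Y y : TangentSpace (𝓡 (2 * n + 1)) y)) =ᶠ[𝓝 x] fun _ => 0 := by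
    filter_upwards [h.isOpen.mem_nhds hx] with y hy
    exact h.apply_section hy (Y y)
  have h3 : (fun y => α y (ν y)) =ᶠ[𝓝 x] fun _ => 1 := by
    filter_upwards [h.isOpen.mem_nhds hx] with y hy
    exact (hν y hy).1
  rw [(hν x hx).2, differential_eq_zero_of_eventuallyEq h2,
    differential_eq_zero_of_eventuallyEq h3] at h1
  rw [h.mem_plane_iff x hx]
  simpa using h1

/-- The derivative of the Reeb momentum along the geodesic flow. -/
theorem differential_reebMomentum_sgrad (hn : 1 ≤ n) (hα : S.IsNormalizedContactForm U α)
    (hν : ∀ x ∈ U, IsReebVectorOf α x (ν x)) {Y : ∀ x : M, S.plane x}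
    (hY : S.SmoothSectionOn Y U) {ζ : CotangentBundle (𝓡 (2 * n + 1)) M} (hζ : ζ.1 ∈ U)
    (hYζ : Y ζ.1 = S.sharp ζ.1 ζ.2) :
    differential (cotangentModel (𝓡 (2 * n + 1))) S.reebMomentum ζ
        (sgrad (𝓡 (2 * n + 1)) S.hamiltonian ζ) =
      ζ.2 (ν ζ.1) * (differential (𝓡 (2 * n + 1)) (fun x => S.metric x (Y x) (Y x)) ζ.1 (ν ζ.1) -
        2 * S.metric ζ.1 (Y ζ.1)
          ⟨_, hα.isContactFormOn.mlieBracket_reeb_mem hn hν hY hζ⟩) := by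
  have hsν := hα.isContactFormOn.smooth_reeb hn hν
  have hνd := hsν.mdifferentiableAt hα.1 hζ
  have h1 : S.reebMomentum =ᶠ[𝓝 ζ] fun ξ => momentum ν ξ ^ 2 := by
    filter_upwards [(isOpen_proj_preimage hα.1).mem_nhds hζ] with ξ hξ
    exact reebMomentum_eq hn hα hν hξ
  have h2 : differential (cotangentModel (𝓡 (2 * n + 1))) S.reebMomentum ζ =
      differential (cotangentModel (𝓡 (2 * n + 1))) (fun ξ => momentum ν ξ ^ 2) ζ :=
    h1.mfderiv_eq
  have hg : MDifferentiableAt (𝓡 (2 * n + 1)) 𝓘(ℝ, ℝ) (fun x => S.metric x (Y x) (Y x)) ζ.1 :=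
    ((S.metric_smooth U Y Y hα.1 hY hY).contMDiffAt (hα.1.mem_nhds hζ)).mdifferentiableAt (by simp)
  -- Antisymmetry of Ω moves the derivative from the flow of H to the lift L of ν: 2 P_ν
  -- dP_ν(`sgrad` H) = -2 P_ν dH(L). Then dH is replaced by the differential of P_Y - g(Y, Y)/2.
  rw [h2, differential_sq (mdifferentiableAt_momentum hα.1 hsν hζ),
    ← symplecticForm_cotangentLift hνd, symplecticForm_swap, sgrad_spec,
    differential_hamiltonian hα.1 hY hζ hYζ,
    differential_momentum_cotangentLift (hY.mdifferentiableAt hα.1 hζ),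
    differential_comp_proj (f := fun x => S.metric x (Y x) (Y x)) hg]
  have h3 : S.metric ζ.1 (Y ζ.1) ⟨_, hα.isContactFormOn.mlieBracket_reeb_mem hn hν hY hζ⟩ =
      ζ.2 (mlieBracket (𝓡 (2 * n + 1)) ν
        (fun y => (Y y : TangentSpace (𝓡 (2 * n + 1)) y)) ζ.1) := by
    rw [hYζ, metric_sharp]
  rw [h3]
  unfold momentum
  ring

theorem ReebSymmetric.isFirstIntegral (hn : 1 ≤ n) (h : S.ReebSymmetric) :
    IsFirstIntegral (𝓡 (2 * n + 1)) S.hamiltonian S.reebMomentum := by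
  rw [isFirstIntegral_iff S.contMDiff_hamiltonian
    fun ζ => (S.contMDiffAt_reebMomentum hn ζ).mdifferentiableAt (by simp)]
  intro ζ
  obtain ⟨U, α, hxU, hα⟩ := S.exists_isNormalizedContactForm hn ζ.1
  obtain ⟨V, hV, hxV, Y, hY, hYζ⟩ := S.exists_section_through ζ.1 (S.sharp ζ.1 ζ.2)
  have hα' := hα.mono (hα.1.inter hV) inter_subset_left
  have hY' : S.SmoothSectionOn Y (U ∩ V) := SmoothFieldOn.mono hY inter_subset_right
  obtain ⟨ν, hν⟩ := hα'.isContactFormOn.exists_reeb hn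
  -- Only the diagonal of L_ν g is needed, on a section Y through `sharp` p.
  obtain ⟨h1, _, h2⟩ := h _ α ν hα' hν Y Y hY' hY' ζ.1 ⟨hxU, hxV⟩
  rw [differential_reebMomentum_sgrad hn hα' hν hY' ⟨hxU, hxV⟩ hYζ]
  rw [S.metric_symm ζ.1 ⟨_, h1⟩] at h2
  have h3 : differential (𝓡 (2 * n + 1)) (fun x => S.metric x (Y x) (Y x)) ζ.1 (ν ζ.1) = _ :=
    h2.symm
  rw [h3]
  ring

/-- There are covectors with prescribed Reeb momentum and prescribed dual vector. -/
theorem IsContactFormOn.exists_covector (h : S.IsContactFormOn U α) {x : M} (hx : x ∈ U)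
    {v : TangentSpace (𝓡 (2 * n + 1)) x} (hv : IsReebVectorOf α x v) (u : S.plane x) :
    ∃ p : TangentSpace (𝓡 (2 * n + 1)) x →L[ℝ] ℝ, p v = 1 ∧ S.sharp x p = u := by
  -- π projects onto Π along the Reeb vector v, and the covector is g(u, π ·) + α: the first term
  -- prescribes `sharp`, the second the value on v.
  let π : TangentSpace (𝓡 (2 * n + 1)) x →ₗ[ℝ] S.plane x :=
    (LinearMap.id - (α x).toLinearMap.smulRight v).codRestrict (S.plane x) fun w => by
      rw [h.mem_plane_iff x hx]
      simp [hv.1]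
  let p : TangentSpace (𝓡 (2 * n + 1)) x →L[ℝ] ℝ :=
    (LinearMap.toContinuousLinearMap (((S.metric x u).comp π).comp
      (modelEquiv (𝓡 (2 * n + 1)) x).symm.toLinearMap)).comp
        (modelEquiv (𝓡 (2 * n + 1)) x).toContinuousLinearMap + α x
  have hp : ∀ w, p w = S.metric x u (π w) + α x w := fun _ => rfl
  have hπv : π v = 0 := Subtype.ext (by simp [π, hv.1])
  have hπ : ∀ w : S.plane x, π w = w := fun w => Subtype.ext (by simp [π, h.apply_section hx w])
  refine ⟨p, ?_, sharp_eq_of_forall fun w => ?_⟩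
  · rw [hp, hπv, map_zero, zero_add, hv.1]
  · rw [hp, hπ, h.apply_section hx w, add_zero]

/-- A covector with p(ν) = 1 and `sharp` p = Z x removes the factor P_ν and gives (L_ν g)(Z, Z) = 0
for every section Z. Polarizing with Z = X + Y, X and Y gives the bilinear identity. -/
theorem reebSymmetric_of_isFirstIntegral (hn : 1 ≤ n)
    (h : IsFirstIntegral (𝓡 (2 * n + 1)) S.hamiltonian S.reebMomentum) : S.ReebSymmetric := by
  rw [isFirstIntegral_iff S.contMDiff_hamiltonian
    fun ζ => (S.contMDiffAt_reebMomentum hn ζ).mdifferentiableAt (by simp)] at h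
  intro U α ν hα hν X Y hX hY x hx
  have hc := hα.isContactFormOn
  have quad : ∀ Z : ∀ x : M, S.plane x, ∀ hZ : S.SmoothSectionOn Z U,
      differential (𝓡 (2 * n + 1)) (fun x => S.metric x (Z x) (Z x)) x (ν x) =
        2 * S.metric x (Z x) ⟨_, hc.mlieBracket_reeb_mem hn hν hZ hx⟩ := by
    intro Z hZ
    obtain ⟨p, hp1, hp2⟩ := hc.exists_covector hx (hν x hx) (Z x)
    have h1 := differential_reebMomentum_sgrad hn hα hν hZ
      (ζ := (⟨x, p⟩ : CotangentBundle (𝓡 (2 * n + 1)) M)) hx hp2.symm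
    rw [h] at h1
    simp only [hp1, one_mul] at h1
    linarith
  have hXY : S.SmoothSectionOn (fun y => X y + Y y) U := by
    have := SmoothFieldOn.sum_smul (s := Finset.univ) (c := fun (_ : Fin 2) (_ : M) => (1 : ℝ))
      (X := ![fun y => (X y : TangentSpace (𝓡 (2 * n + 1)) y),
        fun y => (Y y : TangentSpace (𝓡 (2 * n + 1)) y)]) (U := U)
      (fun i _ => contMDiffOn_const) (fun i _ => by fin_cases i; exacts [hX, hY])
    unfold SmoothSectionOn
    simpa [Fin.sum_univ_two] using this
  refine ⟨hc.mlieBracket_reeb_mem hn hν hX hx, hc.mlieBracket_reeb_mem hn hν hY hx, ?_⟩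
  have hbr : (⟨_, hc.mlieBracket_reeb_mem hn hν hXY hx⟩ : S.plane x) =
      ⟨_, hc.mlieBracket_reeb_mem hn hν hX hx⟩ + ⟨_, hc.mlieBracket_reeb_mem hn hν hY hx⟩ :=
    Subtype.ext (mlieBracket_add_right (hX.mdifferentiableAt hα.1 hx)
      (hY.mdifferentiableAt hα.1 hx))
  have hd : ∀ Z W : ∀ x : M, S.plane x, S.SmoothSectionOn Z U → S.SmoothSectionOn W U →
      MDifferentiableAt (𝓡 (2 * n + 1)) 𝓘(ℝ, ℝ) (fun x => S.metric x (Z x) (W x)) x :=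
    fun Z W hZ hW =>
      ((S.metric_smooth U Z W hα.1 hZ hW).contMDiffAt (hα.1.mem_nhds hx)).mdifferentiableAt (by simp)
  have hexp : (fun y => S.metric y (X y + Y y) (X y + Y y)) = fun y =>
      (S.metric y (X y) (X y) + S.metric y (Y y) (Y y)) + 2 * S.metric y (X y) (Y y) := by
    funext y
    simp only [map_add, LinearMap.add_apply, S.metric_symm y (Y y) (X y)]
    ring
  have h2 : MDifferentiableAt (𝓡 (2 * n + 1)) 𝓘(ℝ, ℝ) (fun y => 2 * S.metric y (X y) (Y y)) x :=
    ((hd X Y hX hY).hasMFDerivAt.const_smul (2 : ℝ)).mdifferentiableAt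
  have h3 : MDifferentiableAt (𝓡 (2 * n + 1)) 𝓘(ℝ, ℝ)
      (fun y => S.metric y (X y) (X y) + S.metric y (Y y) (Y y)) x :=
    ((hd X X hX hX).hasMFDerivAt.add (hd Y Y hY hY).hasMFDerivAt).mdifferentiableAt
  have q := quad _ hXY
  rw [hbr, hexp, differential_add h3 h2, differential_add (hd X X hX hX) (hd Y Y hY hY),
    differential_const_mul _ (hd X Y hX hY)] at q
  simp only [add_apply, smul_apply, smul_eq_mul, map_add, LinearMap.add_apply] at q
  have qX := quad _ hX
  have qY := quad _ hY
  have goal : S.metric x ⟨_, hc.mlieBracket_reeb_mem hn hν hX hx⟩ (Y x) +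
      S.metric x (X x) ⟨_, hc.mlieBracket_reeb_mem hn hν hY hx⟩ =
      differential (𝓡 (2 * n + 1)) (fun y => S.metric y (X y) (Y y)) x (ν x) := by
    rw [S.metric_symm x ⟨_, hc.mlieBracket_reeb_mem hn hν hX hx⟩ (Y x)]
    linarith
  exact goal

end ContactSubRiemannian

end ContactSR

end

theorem proposition11 (n : ℕ) (hn : 1 ≤ n) {M : Type*} [TopologicalSpace M]
    [ChartedSpace (EuclideanSpace ℝ (Fin (2 * n + 1))) M]
    [IsManifold (𝓡 (2 * n + 1)) ∞ M] (S : ContactSR.ContactSubRiemannian n M) :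
    S.ReebSymmetric ↔
      ContactSR.IsFirstIntegral (𝓡 (2 * n + 1)) S.hamiltonian S.reebMomentum :=
  ⟨fun h => h.isFirstIntegral hn,
    ContactSR.ContactSubRiemannian.reebSymmetric_of_isFirstIntegral hn⟩
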